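/- Setting. For $W\in\mathbb R^{m\times c\times(2s+1)}$ and $x\in\mathbb R^{c\times D}$ (positions taken modulo $D$) let $(W*x)_{r,j}=\sum_{k=1}^{c}\sum_{l=-s}^{s}W_{rk,l}\,x_{k,j+l}$, and for $a\in\mathbb R^m$ let $$f_{a,W}(x)=\frac1{\sqrt m}\sum_{r=1}^m a_r\,\frac1D\sum_{j=1}^D\max\{(W*x)_{r,j},0\}$$ be the one-hidden-layer ReLU convolutional network with average pooling and $m$ filters. Let $S=\{(x_i,y_i)\}_{i=1}^n$, $n\ge1$, be a data set with $|y_i|\le B$, all of whose patches $\phi_j(x_i)=(x_{i;k,j+l})_{1\le k\le c,\,|l|\le s}$ have norm $1$. Let $p\in[0,1)$ be the pruning rate, $q=1-p$, and suppose that $M=qm$ is an integer. Assume that the matrix $$G^\infty_{ii'}=\mathbb E_{w\sim N(0,I)}\Big[\frac q{D^2}\sum_{j,j'=1}^D\langle\phi_j(x_i),\phi_{j'}(x_{i'})\rangle\,\mathbf 1\{\langle w,\phi_j(x_i)\rangle\ge0,\ \langle w,\phi_{j'}(x_{i'})\rangle\ge0\}\Big]$$ has a positive least eigenvalue $\lambda_0$.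 Initialization: $a_0$ is uniform on $\{-1,1\}^m$ and, independently, $W_0$ has independent standard Gaussian entries. Pre-training: $W_{pre}$ is obtained from $W_0$ by any number of gradient descent steps with learning rate $\eta_{pre}$ on the loss $\frac12\sum_i(f_{a_0,W}(x_i)-y_i)^2$, with $a_0$ frozen and the derivative of the ReLU at $0$ taken to be $1$. Structured pruning: $M$ of the $m$ filters are kept and the others are removed; the kept filters may be chosen at random and may depend on the pre-trained model, but, listed in some order, their initial parameters (entries of $W_0$ and $a_0$) are again independent standard Gaussians and independent uniform signs, as is the case for instance whenever the choice is independent of $(a_0,W_0)$. Fine-tuning: the kept filters are reset to their values in $W_0$, and $W_{fin}$ is obtained by any number of gradient descent steps with learning rate $\eta$ on the same loss for the pruned network (same factor $1/\sqrt m$, kept entries of $a_0$ frozen); the pruned filters of $W_{fin}\in\mathbb R^{m\times c\times(2s+1)}$ are zero. Claim. There are absolute constants $k\in\mathbb N$ and $c_0>0$, and for all $p\in[0,1)$ and $B\ge0$ a constant $C=C(p,B)>0$, such that in the above setting, for every $\delta\in(0,1)$, if $$m\ge\frac{C}{\delta^2}\Big(\frac n{\lambda_0}\Big)^{k}\qquad\text{and}\qquad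 0<\eta,\ \eta_{pre}\le\frac{c_0\lambda_0}{n^2},$$ then with probability at least $1-\delta$, simultaneously for all numbers of pre-training and fine-tuning steps, $$\min_{Q\in\mathbb O}\ \frac{\|QW_{fin}-W_{pre}\|}{\sqrt{\|QW_{fin}\|\,\|W_{pre}\|}}\ \ge\ \frac p2,$$ where $\|\cdot\|$ is the $\ell_2$ norm and $\mathbb O$ is the group of all linear isometries of the space of tensors $\mathbb R^{m\times c\times(2s+1)}$. -/

import Mathlib

open MeasureTheory ProbabilityTheory
open scoped RealInnerProductSpace

noncomputable section

namespace ORCNN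

/-- Convolution tensors with `m` output channels (filters), `c` input channels and kernel size
`2 s + 1`, with the standard `ℓ₂` norm and inner product. -/
abbrev ConvTensor (m c s : ℕ) : Type :=
  EuclideanSpace ℝ (Fin m × Fin c × Fin (2 * s + 1))

/-- A single filter, or a patch of the input: a `c × (2 s + 1)` array with the `ℓ₂` structure. -/
abbrev Patch (c s : ℕ) : Type :=
  EuclideanSpace ℝ (Fin c × Fin (2 * s + 1))

/-- Inputs with `c` channels and length `D`. Positions live in `ZMod D`: this is the circular
padding convention `x_{k, j + D} = x_{k, j}`. -/
abbrev Input (c D : ℕ) : Type :=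
  Fin c → ZMod D → ℝ

/-- The window of width `2 s + 1` of the input `x` around position `j`: its `(k, l)` entry is
`x_{k, j + l}`, where the index `l : Fin (2 s + 1)` stands for the offset `l - s`. -/
def patch {c D : ℕ} (s : ℕ) (x : Input c D) (j : ZMod D) : Patch c s :=
  WithLp.toLp 2 fun kl => x kl.1 (j + (((kl.2 : ℕ) : ZMod D) - (s : ZMod D)))

/-- Convolution `W * x`: output channel `r`, position `j`. -/
def conv {m c s D : ℕ} (W : ConvTensor m c s) (x : Input c D) (r : Fin m) (j : ZMod D) : ℝ :=
  ∑ k : Fin c, ∑ l : Fin (2 * s + 1),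
    W (r, k, l) * x k (j + (((l : ℕ) : ZMod D) - (s : ZMod D)))

/-- The ReLU activation. -/
def relu (z : ℝ) : ℝ := max z 0

/-- The derivative of the ReLU, with the convention that it equals `1` at `0`. -/
def reluDeriv (z : ℝ) : ℝ := if 0 ≤ z then 1 else 0

/-- Average pooling over the positions. -/
def avgPool {m D : ℕ} [NeZero D] (v : Fin m → ZMod D → ℝ) (r : Fin m) : ℝ :=
  (1 / (D : ℝ)) * ∑ j : ZMod D, v r j

/-- The one-hidden-layer ReLU convolutional network with average pooling, with `m` filters and
fully connected weights `a`. The feature map is scaled by `1 / √N`; the original network of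
width `m` has `N = m`, and the network that is left when filters are removed from a network of
width `N` keeps the factor `1 / √N`. -/
def net (N : ℕ) {m c s D : ℕ} [NeZero D] (a : Fin m → ℝ) (W : ConvTensor m c s)
    (x : Input c D) : ℝ :=
  ∑ r : Fin m, a r * avgPool (fun r j => (1 / √(N : ℝ)) * relu (conv W x r j)) r

/-- The squared loss on the data set `(x i, y i)`. -/
def loss (N : ℕ) {m c s D n : ℕ} [NeZero D] (a : Fin m → ℝ) (x : Fin n → Input c D)
    (y : Fin n → ℝ) (W : ConvTensor m c s) : ℝ :=
  (1 / 2) * ∑ i : Fin n, (net N a W (x i) - y i) ^ 2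

/-- The gradient `∂L/∂W` of the squared loss with respect to the convolution tensor, with
`reluDeriv` as the derivative of the ReLU (see `hasGradientAt_loss`). -/
def lossGrad (N : ℕ) {m c s D n : ℕ} [NeZero D] (a : Fin m → ℝ) (x : Fin n → Input c D)
    (y : Fin n → ℝ) (W : ConvTensor m c s) : ConvTensor m c s :=
  WithLp.toLp 2 fun rkl => ∑ i : Fin n, (net N a W (x i) - y i) *
    (a rkl.1 * ((1 / (D : ℝ)) * ∑ j : ZMod D,
      (1 / √(N : ℝ)) * (reluDeriv (conv W (x i) rkl.1 j) * patch s (x i) j rkl.2)))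

/-- Gradient descent on the convolution tensor with learning rate `η`, from `W₀`, with the fully
connected weights `a` frozen: the tensor after `t` steps. -/
def gradDescent (N : ℕ) {m c s D n : ℕ} [NeZero D] (a : Fin m → ℝ) (x : Fin n → Input c D)
    (y : Fin n → ℝ) (η : ℝ) (W₀ : ConvTensor m c s) : ℕ → ConvTensor m c s
  | 0 => W₀
  | t + 1 => gradDescent N a x y η W₀ t - η • lossGrad N a x y (gradDescent N a x y η W₀ t)

/-- The filters of `W` listed by `κ`. -/
def keepFilters {m M c s : ℕ} (κ : Fin M ↪ Fin m) (W : ConvTensor m c s) : ConvTensor M c s :=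
  WithLp.toLp 2 fun rkl => W (κ rkl.1, rkl.2)

/-- The convolution tensor with `m` filters whose filter `κ r` is the filter `r` of `V`, and whose
other (pruned) filters are zero. -/
def zeroPad {m M c s : ℕ} (κ : Fin M ↪ Fin m) (V : ConvTensor M c s) : ConvTensor m c s :=
  WithLp.toLp 2 fun rkl => Function.extend κ (fun r => V (r, rkl.2)) 0 rkl.1

/-- The law of the random initialization of a network with `m` filters: independent uniform signs
for the fully connected weights, and independently of them independent standard Gaussian entries
for the convolution tensor. -/
def initLaw (m c s : ℕ) : Measure ((Fin m → ℝ) × ConvTensor m c s) :=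
  (Measure.pi fun _ : Fin m => uniformOn ({-1, 1} : Set ℝ)).prod
    (stdGaussian (ConvTensor m c s))

/-- The limiting Gram matrix `G^∞` of the network of which the fraction `q` of the filters is
kept: the expectation is over one filter `w` with independent standard Gaussian entries. -/
def gramLimit {c D n : ℕ} [NeZero D] (s : ℕ) (q : ℝ) (x : Fin n → Input c D) :
    Matrix (Fin n) (Fin n) ℝ :=
  Matrix.of fun i i' => ∫ w : Patch c s, q / (D : ℝ) ^ 2 * ∑ j : ZMod D, ∑ j' : ZMod D,
    ⟪patch s (x i) j, patch s (x i') j'⟫ *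
      (reluDeriv ⟪w, patch s (x i) j⟫ * reluDeriv ⟪w, patch s (x i') j'⟫)
    ∂(stdGaussian (Patch c s))

/-- The normalized `ℓ₂` distance of two tensors. -/
def normDist {m c s : ℕ} (A B : ConvTensor m c s) : ℝ :=
  ‖A - B‖ / √(‖A‖ * ‖B‖)

/-- The minimal normalized `ℓ₂` distance of `B` to a rotation `Q A` of `A`. The rotations are all
linear isometries of the space of convolution tensors. -/
def minRotDist {m c s : ℕ} (A B : ConvTensor m c s) : ℝ :=
  ⨅ Q : ConvTensor m c s ≃ₗᵢ[ℝ] ConvTensor m c s, normDist (Q A) B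

/-- Where no preactivation vanishes, `lossGrad` is the gradient of the loss. -/
theorem hasGradientAt_loss (N : ℕ) {m c s D n : ℕ} [NeZero D] (a : Fin m → ℝ)
    (x : Fin n → Input c D) (y : Fin n → ℝ) (W : ConvTensor m c s)
    (hW : ∀ i r j, conv W (x i) r j ≠ 0) :
    HasGradientAt (loss N a x y) (lossGrad N a x y W) W := by
  have hrelu : ∀ z : ℝ, z ≠ 0 → HasDerivAt relu (reluDeriv z) z := by
    intro z hz
    rcases lt_or_gt_of_ne hz with h | h
    · have h0 : reluDeriv z = 0 := by simp [reluDeriv, h]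
      rw [h0]
      refine (hasDerivAt_const z (0 : ℝ)).congr_of_eventuallyEq ?_
      filter_upwards [Iio_mem_nhds h] with w hw
      exact max_eq_right (le_of_lt hw)
    · have h1 : reluDeriv z = 1 := by simp [reluDeriv, h.le]
      rw [h1]
      refine (hasDerivAt_id z).congr_of_eventuallyEq ?_
      filter_upwards [Ioi_mem_nhds h] with w hw
      exact max_eq_left (le_of_lt hw)
  have hconv : ∀ (z : Input c D) (r : Fin m) (j : ZMod D),
      HasFDerivAt (fun V : ConvTensor m c s => conv V z r j)
        (∑ k : Fin c, ∑ l : Fin (2 * s + 1), (patch s z j (k, l)) •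
          (EuclideanSpace.proj (r, k, l) : ConvTensor m c s →L[ℝ] ℝ)) W := by
    intro z r j
    unfold conv
    refine HasFDerivAt.fun_sum fun k _ => HasFDerivAt.fun_sum fun l _ => ?_
    exact ((EuclideanSpace.proj (r, k, l) : ConvTensor m c s →L[ℝ] ℝ).hasFDerivAt).mul_const _
  have hnet : ∀ i, HasFDerivAt (fun V : ConvTensor m c s => net N a V (x i))
      (∑ r : Fin m, a r • ((1 / (D : ℝ)) • ∑ j : ZMod D, (1 / √(N : ℝ)) •
        (reluDeriv (conv W (x i) r j) • ∑ k : Fin c, ∑ l : Fin (2 * s + 1),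
          (patch s (x i) j (k, l)) •
            (EuclideanSpace.proj (r, k, l) : ConvTensor m c s →L[ℝ] ℝ)))) W := by
    intro i
    unfold net avgPool
    refine HasFDerivAt.fun_sum fun r _ => HasFDerivAt.const_mul ?_ _
    refine HasFDerivAt.const_mul ?_ _
    refine HasFDerivAt.fun_sum fun j _ => HasFDerivAt.const_mul ?_ _
    exact (hrelu _ (hW i r j)).comp_hasFDerivAt W (hconv (x i) r j)
  have hloss : HasFDerivAt (loss N a x y) ((1 / 2 : ℝ) • ∑ i : Fin n,
      ((2 * (net N a W (x i) - y i)) • (∑ r : Fin m, a r • ((1 / (D : ℝ)) • ∑ j : ZMod D,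
        (1 / √(N : ℝ)) • (reluDeriv (conv W (x i) r j) • ∑ k : Fin c, ∑ l : Fin (2 * s + 1),
          (patch s (x i) j (k, l)) •
            (EuclideanSpace.proj (r, k, l) : ConvTensor m c s →L[ℝ] ℝ)))))) W := by
    unfold loss
    refine HasFDerivAt.const_mul ?_ _
    refine HasFDerivAt.fun_sum fun i _ => ?_
    have := ((hnet i).sub_const (y i)).pow 2
    simpa using this
  rw [hasGradientAt_iff_hasFDerivAt]
  refine hloss.congr_fderiv ?_
  ext v
  rw [InnerProductSpace.toDual_apply_apply, PiLp.inner_apply, Fintype.sum_prod_type]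
  simp only [lossGrad, smul_apply, sum_apply, smul_eq_mul, PiLp.proj_apply,
    Fintype.sum_prod_type, RCLike.inner_apply, conj_trivial, Finset.mul_sum]
  rw [Finset.sum_comm]
  refine Finset.sum_congr rfl fun r _ => ?_
  have hcomm : ∀ g : Fin n → ZMod D → Fin c → Fin (2 * s + 1) → ℝ,
      ∑ i, ∑ j, ∑ k, ∑ l, g i j k l = ∑ k, ∑ l, ∑ i, ∑ j, g i j k l := by
    intro g
    have h1 : ∀ i, ∑ j, ∑ k, ∑ l, g i j k l = ∑ k, ∑ l, ∑ j, g i j k l := by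
      intro i
      rw [Finset.sum_comm]
      exact Finset.sum_congr rfl fun k _ => Finset.sum_comm
    rw [Finset.sum_congr rfl fun i _ => h1 i, Finset.sum_comm]
    exact Finset.sum_congr rfl fun k _ => Finset.sum_comm
  rw [hcomm]
  refine Finset.sum_congr rfl fun k _ => Finset.sum_congr rfl fun l _ =>
    Finset.sum_congr rfl fun i _ => Finset.sum_congr rfl fun j _ => ?_
  ring

end ORCNN

end

noncomputable section

namespace ORCNN

/-!
A wide network is trained lazily. With high probability the initialization makes the tangent kernel
of the residuals at least `3 / 4 * lam` (Chebyshev, since the expected kernel is the limiting Gram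
matrix) and leaves few units whose activation could change while every filter stays within a small
radius `R` of its initial value. As long as the filters stay in this radius the kernel remains
coercive, so the residual contracts geometrically, and the total displacement of a filter, bounded
by the sum of the residual norms over all steps, is indeed at most `R`. Hence the norm of the
trained tensor stays close to the norm of its initialization, which is close to the square root of
the number of entries. For the pruned and the full network these square roots have ratio
`√(1 - p)`. Rotations preserve norms, so the rotation distance is at least the normalized difference
of the two norms, about `(1 - √(1 - p)) / (1 - p) ^ (1 / 4)`, which leaves room above `p / 2`.
-/

section Mean

variable {J E : Type*} [Fintype J] [NormedAddCommGroup E] [NormedSpace ℝ E]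

/-- The average of a finite family of vectors, here of the terms at the positions of a patch.
Mathlib's `𝔼` would ask for a `ℚ≥0`-module. The average of the empty family is `0`. -/
def mean (g : J → E) : E := (Fintype.card J : ℝ)⁻¹ • ∑ j, g j

lemma mean_sub (g h : J → E) : mean (fun j => g j - h j) = mean g - mean h := by
  simp only [mean, Finset.sum_sub_distrib, smul_sub]

lemma mean_mul_const (g : J → ℝ) (b : ℝ) : mean (fun j => g j * b) = mean g * b := by
  simp only [mean, ← Finset.sum_mul, smul_eq_mul, mul_assoc]

lemma mean_mono {g h : J → ℝ} (H : ∀ j, g j ≤ h j) : mean g ≤ mean h := by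
  unfold mean
  gcongr
  exact H _

lemma mean_nonneg {g : J → ℝ} (hg : ∀ j, 0 ≤ g j) : 0 ≤ mean g :=
  smul_nonneg (by positivity) (Finset.sum_nonneg fun j _ => hg j)

lemma mean_le {g : J → ℝ} {b : ℝ} (hb : 0 ≤ b) (hg : ∀ j, g j ≤ b) : mean g ≤ b :=
  calc mean g ≤ mean fun _ : J => b := mean_mono hg
    _ = (Fintype.card J : ℝ)⁻¹ * Fintype.card J * b := by simp [mean, mul_assoc]
    _ ≤ b := mul_le_of_le_one_left hb inv_mul_le_one

lemma norm_mean_le {g : J → E} {b : J → ℝ} (hg : ∀ j, ‖g j‖ ≤ b j) : ‖mean g‖ ≤ mean b := by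
  rw [mean, mean, norm_smul, Real.norm_of_nonneg (by positivity), smul_eq_mul]
  gcongr
  exact norm_sum_le_of_le _ fun j _ => hg j

lemma sq_mean_le (g : J → ℝ) : mean g ^ 2 ≤ mean fun j => g j ^ 2 := by
  simp only [mean, smul_eq_mul, mul_pow]
  calc ((Fintype.card J : ℝ)⁻¹) ^ 2 * (∑ j, g j) ^ 2
      ≤ ((Fintype.card J : ℝ)⁻¹) ^ 2 * (Fintype.card J * ∑ j, g j ^ 2) := by
        gcongr
        exact sq_sum_le_card_mul_sum_sq
    _ = (Fintype.card J : ℝ)⁻¹ * Fintype.card J *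
          ((Fintype.card J : ℝ)⁻¹ * ∑ j, g j ^ 2) := by ring
    _ ≤ _ := mul_le_of_le_one_left (by positivity) inv_mul_le_one

end Mean

section Relu

lemma abs_reluDeriv_le_one (b : ℝ) : |reluDeriv b| ≤ 1 := by
  unfold reluDeriv
  split_ifs <;> norm_num

lemma relu_sq_le (b : ℝ) : relu b ^ 2 ≤ b ^ 2 :=
  sq_le_sq.mpr (by rw [relu]; exact abs_max_le_max_abs_abs.trans (by simp))

lemma abs_reluDeriv_sub_le {b b₀ R : ℝ} (h : |b - b₀| ≤ R) :
    |reluDeriv b - reluDeriv b₀| ≤ if |b₀| ≤ R then 1 else 0 := by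
  unfold reluDeriv
  grind

lemma abs_relu_sub_linear_le {b b' b₀ R : ℝ} (h : |b - b₀| ≤ R) (h' : |b' - b₀| ≤ R) :
    |relu b' - relu b - reluDeriv b * (b' - b)| ≤ (if |b₀| ≤ R then 1 else 0) * |b' - b| := by
  unfold relu reluDeriv
  rcases le_total 0 b with hb | hb <;> rcases le_total 0 b' with hb' | hb' <;>
    simp only [max_eq_left, max_eq_right, hb, hb'] <;> split_ifs <;> grind

end Relu

section AvgRelu

variable {V : Type*} [NormedAddCommGroup V] [InnerProductSpace ℝ V]
variable {J : Type*} [Fintype J]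

/-- The response of the filter `w` to an input with patches `z`: average pooling of the ReLU of
the preactivations. -/
def avgRelu (z : J → V) (w : V) : ℝ := mean fun j => relu ⟪w, z j⟫

/-- The gradient of `avgRelu z` at `w`, with `reluDeriv` as the derivative of the ReLU. -/
def avgReluGrad (z : J → V) (w : V) : V := mean fun j => reluDeriv ⟪w, z j⟫ • z j

/-- The fraction of the patches `z` whose activation may change when the filter `w` moves by at
most `R`. -/
def unstableFrac (R : ℝ) (z : J → V) (w : V) : ℝ := mean fun j => if |⟪w, z j⟫| ≤ R then 1 else 0

lemma abs_inner_sub_inner_le {w w' u : V} (hu : ‖u‖ = 1) : |⟪w', u⟫ - ⟪w, u⟫| ≤ ‖w' - w‖ := by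
  rw [← inner_sub_left]
  simpa only [hu, mul_one] using abs_real_inner_le_norm (w' - w) u

lemma unstableFrac_nonneg (R : ℝ) (z : J → V) (w : V) : 0 ≤ unstableFrac R z w :=
  mean_nonneg fun j => by split_ifs <;> norm_num

lemma unstableFrac_le_one (R : ℝ) (z : J → V) (w : V) : unstableFrac R z w ≤ 1 :=
  mean_le zero_le_one fun j => by split_ifs <;> norm_num

lemma sq_avgRelu_le (z : J → V) (w : V) : avgRelu z w ^ 2 ≤ mean fun j => ⟪w, z j⟫ ^ 2 :=
  (sq_mean_le _).trans (mean_mono fun _ => relu_sq_le _)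

lemma inner_avgReluGrad_avgReluGrad (z z' : J → V) (w : V) :
    ⟪avgReluGrad z w, avgReluGrad z' w⟫ = (Fintype.card J : ℝ)⁻¹ ^ 2 * ∑ j, ∑ j',
      ⟪z j, z' j'⟫ * (reluDeriv ⟪w, z j⟫ * reluDeriv ⟪w, z' j'⟫) := by
  simp only [avgReluGrad, mean, real_inner_smul_left, real_inner_smul_right, sum_inner, inner_sum,
    Finset.mul_sum]
  rw [Finset.sum_comm]
  exact Finset.sum_congr rfl fun j _ => Finset.sum_congr rfl fun j' _ => by ring

variable {z : J → V} (hz : ∀ j, ‖z j‖ = 1)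
include hz

lemma norm_avgReluGrad_le_one (w : V) : ‖avgReluGrad z w‖ ≤ 1 :=
  (norm_mean_le fun j => by
    rw [norm_smul, hz, mul_one]
    exact abs_reluDeriv_le_one _).trans (mean_le zero_le_one fun _ => le_rfl)

lemma abs_inner_avgReluGrad_le_one {z' : J → V} (hz' : ∀ j, ‖z' j‖ = 1) (w : V) :
    |⟪avgReluGrad z w, avgReluGrad z' w⟫| ≤ 1 :=
  (abs_real_inner_le_norm _ _).trans
    (mul_le_one₀ (norm_avgReluGrad_le_one hz w) (norm_nonneg _) (norm_avgReluGrad_le_one hz' w))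

lemma norm_avgReluGrad_sub_le {w w₀ : V} {R : ℝ} (hw : ‖w - w₀‖ ≤ R) :
    ‖avgReluGrad z w - avgReluGrad z w₀‖ ≤ unstableFrac R z w₀ := by
  rw [avgReluGrad, avgReluGrad, ← mean_sub]
  refine norm_mean_le fun j => ?_
  rw [← sub_smul, norm_smul, hz, mul_one]
  exact abs_reluDeriv_sub_le ((abs_inner_sub_inner_le (hz j)).trans hw)

lemma abs_avgRelu_sub_linear_le {w w' w₀ : V} {R : ℝ}
    (hw : ‖w - w₀‖ ≤ R) (hw' : ‖w' - w₀‖ ≤ R) :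
    |avgRelu z w' - avgRelu z w - ⟪avgReluGrad z w, w' - w⟫| ≤
      unstableFrac R z w₀ * ‖w' - w‖ := by
  have hgrad : ⟪avgReluGrad z w, w' - w⟫ =
      mean fun j => reluDeriv ⟪w, z j⟫ * (⟪w', z j⟫ - ⟪w, z j⟫) := by
    rw [real_inner_comm]
    simp only [avgReluGrad, mean, real_inner_smul_right, inner_sum, ← inner_sub_left, smul_eq_mul]
  rw [hgrad, avgRelu, avgRelu, ← mean_sub, ← mean_sub, unstableFrac, ← mean_mul_const,
    ← Real.norm_eq_abs]
  refine norm_mean_le fun j => ?_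
  refine (abs_relu_sub_linear_le ((abs_inner_sub_inner_le (hz j)).trans hw)
    ((abs_inner_sub_inner_le (hz j)).trans hw')).trans ?_
  gcongr
  exact abs_inner_sub_inner_le (hz j)

end AvgRelu

section EuclideanSpace

variable {ι : Type*} [Fintype ι]

lemma sum_abs_le_sqrt_card_mul_norm (e : EuclideanSpace ℝ ι) :
    ∑ i, |e i| ≤ √(Fintype.card ι) * ‖e‖ := by
  rw [EuclideanSpace.norm_eq, ← Real.sqrt_mul (by positivity)]
  exact Real.le_sqrt_of_sq_le sq_sum_le_card_mul_sum_sq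

lemma norm_le_sqrt_card_mul {x : EuclideanSpace ℝ ι} {b : ℝ} (hb : 0 ≤ b) (hx : ∀ i, |x i| ≤ b) :
    ‖x‖ ≤ √(Fintype.card ι) * b := by
  rw [EuclideanSpace.norm_eq, ← Real.sqrt_sq hb, ← Real.sqrt_mul (by positivity)]
  gcongr
  simpa using Finset.sum_le_card_nsmul Finset.univ _ (b ^ 2)
    fun i _ => pow_le_pow_left₀ (abs_nonneg _) (hx i) 2

end EuclideanSpace

section InnerProductSpace

variable {E : Type*} [NormedAddCommGroup E] [InnerProductSpace ℝ E]

lemma sq_norm_sub_mul_le (a b : E) : ‖b‖ ^ 2 - 2 * ‖b‖ * ‖a - b‖ ≤ ‖a‖ ^ 2 := by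
  have h : ‖a‖ ^ 2 = ‖b‖ ^ 2 + 2 * ⟪b, a - b⟫ + ‖a - b‖ ^ 2 := by
    rw [← norm_add_sq_real, add_sub_cancel]
  nlinarith [neg_le_of_abs_le (abs_real_inner_le_norm b (a - b)), sq_nonneg ‖a - b‖]

lemma norm_sub_smul_le_of_le_inner {e p : E} {μ L η : ℝ} (hη : 0 ≤ η) (hμ : μ * ‖e‖ ^ 2 ≤ ⟪e, p⟫)
    (hL : ‖p‖ ≤ L * ‖e‖) (hηL : η * L ^ 2 ≤ μ) (hημ : η * μ ≤ 2) :
    ‖e - η • p‖ ≤ (1 - η * μ / 2) * ‖e‖ := by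
  refine le_of_sq_le_sq ?_ (mul_nonneg (by linarith) (norm_nonneg e))
  calc ‖e - η • p‖ ^ 2 = ‖e‖ ^ 2 - 2 * η * ⟪e, p⟫ + η * (η * ‖p‖ ^ 2) := by
        rw [norm_sub_sq_real, real_inner_smul_right, norm_smul, Real.norm_of_nonneg hη]; ring
    _ ≤ ‖e‖ ^ 2 - 2 * η * (μ * ‖e‖ ^ 2) + η * (η * (L * ‖e‖) ^ 2) := by gcongr
    _ = ‖e‖ ^ 2 - 2 * η * (μ * ‖e‖ ^ 2) + η * (η * L ^ 2 * ‖e‖ ^ 2) := by ring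
    _ ≤ ‖e‖ ^ 2 - 2 * η * (μ * ‖e‖ ^ 2) + η * (μ * ‖e‖ ^ 2) := by gcongr
    _ ≤ ((1 - η * μ / 2) * ‖e‖) ^ 2 := by nlinarith [sq_nonneg (η * μ * ‖e‖)]

end InnerProductSpace

section Dynamics

variable {V : Type*} [NormedAddCommGroup V] [InnerProductSpace ℝ V]
variable {J ι F : Type*} [Fintype J]

section Residual

variable [Fintype F]

/-- The errors on the data with patches `z` and labels `y` of the network with filters `w`, output
weights `a` and scaling factor `θ`. -/
def residual (θ : ℝ) (a : F → ℝ) (z : ι → J → V) (y : ι → ℝ) (w : F → V) : EuclideanSpace ℝ ι :=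
  WithLp.toLp 2 fun i => θ * ∑ r, a r * avgRelu (z i) (w r) - y i

lemma abs_residual_sub_linear_le {z : ι → J → V} (hz : ∀ i j, ‖z i j‖ = 1) {θ : ℝ} (hθ : 0 ≤ θ)
    {a : F → ℝ} (ha : ∀ r, |a r| = 1) (y : ι → ℝ) {w₀ w w' : F → V}
    {R : ℝ} (hw : ∀ r, ‖w r - w₀ r‖ ≤ R) (hw' : ∀ r, ‖w' r - w₀ r‖ ≤ R) (i : ι) :
    |residual θ a z y w' i - residual θ a z y w i -
        ∑ r, θ * a r * ⟪avgReluGrad (z i) (w r), w' r - w r⟫| ≤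
      ∑ r, θ * (unstableFrac R (z i) (w₀ r) * ‖w' r - w r‖) := by
  have hsum : residual θ a z y w' i - residual θ a z y w i -
      ∑ r, θ * a r * ⟪avgReluGrad (z i) (w r), w' r - w r⟫ =
      ∑ r, θ * a r * (avgRelu (z i) (w' r) - avgRelu (z i) (w r) -
        ⟪avgReluGrad (z i) (w r), w' r - w r⟫) := by
    simp only [residual, mul_sub, Finset.sum_sub_distrib, Finset.mul_sum, mul_assoc]
    ring
  rw [hsum]
  refine norm_sum_le_of_le (E := ℝ) _ fun r _ => ?_
  rw [Real.norm_eq_abs, abs_mul, abs_mul, ha, mul_one, abs_of_nonneg hθ]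
  gcongr
  exact abs_avgRelu_sub_linear_le (hz i) (hw r) (hw' r)

end Residual

variable [Fintype ι]

/-- The gradient of the squared loss with respect to the filter `r`, for errors `e`. -/
def filterGrad (θ : ℝ) (a : F → ℝ) (z : ι → J → V) (e : EuclideanSpace ℝ ι) (w : F → V) (r : F) :
    V :=
  (θ * a r) • ∑ i, e i • avgReluGrad (z i) (w r)

section FilterGrad

variable {z : ι → J → V} (hz : ∀ i j, ‖z i j‖ = 1)
include hz

lemma norm_sum_smul_avgReluGrad_le (e : EuclideanSpace ℝ ι) (v : V) :
    ‖∑ i, e i • avgReluGrad (z i) v‖ ≤ √(Fintype.card ι) * ‖e‖ := by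
  refine (norm_sum_le_of_le _ fun i _ => ?_).trans (sum_abs_le_sqrt_card_mul_norm e)
  rw [norm_smul, Real.norm_eq_abs]
  exact mul_le_of_le_one_right (abs_nonneg _) (norm_avgReluGrad_le_one (hz i) v)

lemma sq_norm_sum_smul_avgReluGrad_ge (e : EuclideanSpace ℝ ι) {v v₀ : V} {R : ℝ}
    (hv : ‖v - v₀‖ ≤ R) :
    ‖∑ i, e i • avgReluGrad (z i) v₀‖ ^ 2 -
        2 * (√(Fintype.card ι) * ‖e‖) * ∑ i, |e i| * unstableFrac R (z i) v₀ ≤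
      ‖∑ i, e i • avgReluGrad (z i) v‖ ^ 2 := by
  have hdiff : ‖∑ i, e i • avgReluGrad (z i) v - ∑ i, e i • avgReluGrad (z i) v₀‖ ≤
      ∑ i, |e i| * unstableFrac R (z i) v₀ := by
    rw [← Finset.sum_sub_distrib]
    refine norm_sum_le_of_le _ fun i _ => ?_
    rw [← smul_sub, norm_smul, Real.norm_eq_abs]
    gcongr
    exact norm_avgReluGrad_sub_le (hz i) hv
  refine le_trans ?_ (sq_norm_sub_mul_le _ (∑ i, e i • avgReluGrad (z i) v₀))
  gcongr
  exact norm_sum_smul_avgReluGrad_le hz e v₀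

lemma norm_filterGrad_le {θ : ℝ} (hθ : 0 ≤ θ) {a : F → ℝ} (ha : ∀ r, |a r| = 1)
    (e : EuclideanSpace ℝ ι) (w : F → V) (r : F) :
    ‖filterGrad θ a z e w r‖ ≤ θ * (√(Fintype.card ι) * ‖e‖) := by
  rw [filterGrad, norm_smul, norm_mul, Real.norm_of_nonneg hθ, Real.norm_eq_abs, ha, mul_one]
  gcongr
  exact norm_sum_smul_avgReluGrad_le hz e _

end FilterGrad

variable [Fintype F]

/-- The neural tangent kernel of the network at the filters `w`, applied to the errors `e`: the
first order decrease of the errors along the gradient. -/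
def tangentKernel (θ : ℝ) (a : F → ℝ) (z : ι → J → V) (w : F → V) (e : EuclideanSpace ℝ ι) :
    EuclideanSpace ℝ ι :=
  WithLp.toLp 2 fun i => ∑ r, θ * a r * ⟪avgReluGrad (z i) (w r), filterGrad θ a z e w r⟫

lemma inner_tangentKernel (θ : ℝ) (a : F → ℝ) (z : ι → J → V) (w : F → V)
    (e : EuclideanSpace ℝ ι) :
    ⟪e, tangentKernel θ a z w e⟫ = ∑ r, ‖filterGrad θ a z e w r‖ ^ 2 := by
  simp only [PiLp.inner_apply, tangentKernel, RCLike.inner_apply, conj_trivial, Finset.sum_mul]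
  rw [Finset.sum_comm]
  refine Finset.sum_congr rfl fun r _ => ?_
  calc ∑ i, θ * a r * ⟪avgReluGrad (z i) (w r), filterGrad θ a z e w r⟫ * e i
      = ⟪(θ * a r) • ∑ i, e i • avgReluGrad (z i) (w r), filterGrad θ a z e w r⟫ := by
        rw [real_inner_smul_left, sum_inner, Finset.mul_sum]
        exact Finset.sum_congr rfl fun i _ => by rw [real_inner_smul_left]; ring
    _ = ‖filterGrad θ a z e w r‖ ^ 2 := real_inner_self_eq_norm_sq _

lemma norm_tangentKernel_le {z : ι → J → V} (hz : ∀ i j, ‖z i j‖ = 1) {θ : ℝ} (hθ : 0 ≤ θ)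
    (hθF : θ ^ 2 * Fintype.card F ≤ 1) {a : F → ℝ} (ha : ∀ r, |a r| = 1)
    (e : EuclideanSpace ℝ ι) (w : F → V) :
    ‖tangentKernel θ a z w e‖ ≤ Fintype.card ι * ‖e‖ := by
  have hcoord (i : ι) : |tangentKernel θ a z w e i| ≤ √(Fintype.card ι) * ‖e‖ := by
    have hterm (r : F) : |θ * a r * ⟪avgReluGrad (z i) (w r), filterGrad θ a z e w r⟫| ≤
        θ * (θ * (√(Fintype.card ι) * ‖e‖)) := by
      rw [abs_mul, abs_mul, ha, mul_one, abs_of_nonneg hθ]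
      gcongr
      calc _ ≤ ‖avgReluGrad (z i) (w r)‖ * ‖filterGrad θ a z e w r‖ := abs_real_inner_le_norm _ _
        _ ≤ 1 * (θ * (√(Fintype.card ι) * ‖e‖)) := by
          gcongr
          · exact norm_avgReluGrad_le_one (hz i) _
          · exact norm_filterGrad_le hz hθ ha e w r
        _ = _ := one_mul _
    calc |tangentKernel θ a z w e i|
        ≤ ∑ _r : F, θ * (θ * (√(Fintype.card ι) * ‖e‖)) :=
          norm_sum_le_of_le (E := ℝ) _ fun r _ => hterm r
      _ = θ ^ 2 * Fintype.card F * (√(Fintype.card ι) * ‖e‖) := by simp; ring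
      _ ≤ _ := mul_le_of_le_one_left (by positivity) hθF
  refine (norm_le_sqrt_card_mul (by positivity) hcoord).trans_eq ?_
  rw [← mul_assoc, Real.mul_self_sqrt (by positivity)]

end Dynamics

section LazyTraining

variable {V : Type*} [NormedAddCommGroup V] [InnerProductSpace ℝ V]
variable {J ι F : Type*} [Fintype J] [Fintype ι] [Fintype F]
variable {θ lam R η : ℝ} {a : F → ℝ} {z : ι → J → V} {y : ι → ℝ} {w₀ w w' : F → V}

/-- Filters at which the empirical Gram matrix is bounded below by `3 / 4 * lam`, and at which few
activations change when every filter moves by at most `R`. The network is scaled by `θ`. -/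
structure WellSpread (θ lam R : ℝ) (z : ι → J → V) (w : F → V) : Prop where
  gram_ge (e : EuclideanSpace ℝ ι) :
    3 / 4 * lam * ‖e‖ ^ 2 ≤ θ ^ 2 * ∑ r, ‖∑ i, e i • avgReluGrad (z i) (w r)‖ ^ 2
  unstable_le (i : ι) :
    θ ^ 2 * ∑ r, unstableFrac R (z i) (w r) ≤ lam / (8 * Fintype.card ι)

/-- Initializations from which gradient descent does not move any filter by more than `R`. -/
structure LazyInit (θ lam R : ℝ) (z : ι → J → V) (y : ι → ℝ) (a : F → ℝ) (w : F → V) : Prop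
    extends WellSpread θ lam R z w where
  abs_sign (r : F) : |a r| = 1
  residual_le : 8 * √(Fintype.card ι) * θ * ‖residual θ a z y w‖ ≤ lam * R

lemma residual_le_of_abs_output_lt {τ : ℝ} (hθ : 0 ≤ θ) (hτ : 0 ≤ τ) (hy : ∀ i, |y i| ≤ τ)
    (hout : ∀ i, |θ * ∑ r, a r * avgRelu (z i) (w r)| < τ) :
    8 * √(Fintype.card ι) * θ * ‖residual θ a z y w‖ ≤ 16 * Fintype.card ι * θ * τ := by
  have hres : ‖residual θ a z y w‖ ≤ √(Fintype.card ι) * (τ + τ) :=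
    norm_le_sqrt_card_mul (by positivity) fun i =>
      (abs_sub _ _).trans (add_le_add (hout i).le (hy i))
  calc 8 * √(Fintype.card ι) * θ * ‖residual θ a z y w‖
      ≤ 8 * √(Fintype.card ι) * θ * (√(Fintype.card ι) * (τ + τ)) := by gcongr
    _ = 16 * (√(Fintype.card ι) * √(Fintype.card ι)) * θ * τ := by ring
    _ = 16 * Fintype.card ι * θ * τ := by rw [Real.mul_self_sqrt (by positivity)]

lemma natCast_mul_div_mul_le {x k : ℝ} (hx : 0 ≤ x) (hk : 0 ≤ k) (n : ℕ) :
    n * (x / (k * n)) ≤ x / k := by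
  rcases n.eq_zero_or_pos with rfl | hn
  · simpa using div_nonneg hx hk
  · exact le_of_eq (by field_simp)

lemma WellSpread.inner_tangentKernel_ge (h : WellSpread θ lam R z w₀) (hlam : 0 ≤ lam)
    (ha : ∀ r, |a r| = 1) (hz : ∀ i j, ‖z i j‖ = 1) (hw : ∀ r, ‖w r - w₀ r‖ ≤ R)
    (e : EuclideanSpace ℝ ι) :
    lam / 2 * ‖e‖ ^ 2 ≤ ⟪e, tangentKernel θ a z w e⟫ := by
  set n := (Fintype.card ι : ℝ)
  have hgrad (r : F) :
      ‖filterGrad θ a z e w r‖ ^ 2 = θ ^ 2 * ‖∑ i, e i • avgReluGrad (z i) (w r)‖ ^ 2 := by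
    rw [filterGrad, norm_smul, mul_pow, norm_mul, Real.norm_eq_abs (a r), ha, mul_one,
      Real.norm_eq_abs, sq_abs]
  have hperturb : θ ^ 2 * ∑ r, 2 * (√n * ‖e‖) * ∑ i, |e i| * unstableFrac R (z i) (w₀ r) ≤
      lam / 4 * ‖e‖ ^ 2 := by
    calc θ ^ 2 * ∑ r, 2 * (√n * ‖e‖) * ∑ i, |e i| * unstableFrac R (z i) (w₀ r)
        = 2 * (√n * ‖e‖) * ∑ i, |e i| * (θ ^ 2 * ∑ r, unstableFrac R (z i) (w₀ r)) := by
          simp only [Finset.mul_sum]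
          rw [Finset.sum_comm]
          exact Finset.sum_congr rfl fun i _ => Finset.sum_congr rfl fun r _ => by ring
      _ ≤ 2 * (√n * ‖e‖) * ∑ i, |e i| * (lam / (8 * n)) := by
          gcongr with i
          exact h.unstable_le i
      _ ≤ 2 * (√n * ‖e‖) * (√n * ‖e‖ * (lam / (8 * n))) := by
          rw [← Finset.sum_mul]
          gcongr
          exact sum_abs_le_sqrt_card_mul_norm e
      _ = 2 * ‖e‖ ^ 2 * (√n * √n * (lam / (8 * n))) := by ring
      _ ≤ 2 * ‖e‖ ^ 2 * (lam / 8) := by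
          rw [Real.mul_self_sqrt (by positivity)]
          gcongr
          exact natCast_mul_div_mul_le hlam (by norm_num) _
      _ = lam / 4 * ‖e‖ ^ 2 := by ring
  calc lam / 2 * ‖e‖ ^ 2 = 3 / 4 * lam * ‖e‖ ^ 2 - lam / 4 * ‖e‖ ^ 2 := by ring
    _ ≤ θ ^ 2 * ∑ r, (‖∑ i, e i • avgReluGrad (z i) (w₀ r)‖ ^ 2 -
          2 * (√n * ‖e‖) * ∑ i, |e i| * unstableFrac R (z i) (w₀ r)) := by
        rw [Finset.sum_sub_distrib, mul_sub]
        exact sub_le_sub (h.gram_ge e) hperturb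
    _ ≤ θ ^ 2 * ∑ r, ‖∑ i, e i • avgReluGrad (z i) (w r)‖ ^ 2 := by
        gcongr with r
        exact sq_norm_sum_smul_avgReluGrad_ge hz e (hw r)
    _ = ⟪e, tangentKernel θ a z w e⟫ := by
        simp only [inner_tangentKernel, hgrad, Finset.mul_sum]

section Step

variable (h : WellSpread θ lam R z w₀) (hθ : 0 ≤ θ) (hlam : 0 ≤ lam) (hη : 0 ≤ η)
  (ha : ∀ r, |a r| = 1) (hz : ∀ i j, ‖z i j‖ = 1)
  (hw : ∀ r, ‖w r - w₀ r‖ ≤ R) (hw' : ∀ r, ‖w' r - w₀ r‖ ≤ R)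
  (hstep : ∀ r, w' r = w r - η • filterGrad θ a z (residual θ a z y w) w r)
include h hθ hlam hη ha hz hw hw' hstep

lemma WellSpread.norm_residual_sub_tangentKernel_le :
    ‖residual θ a z y w' -
        (residual θ a z y w - η • tangentKernel θ a z w (residual θ a z y w))‖ ≤
      η * lam / 8 * ‖residual θ a z y w‖ := by
  set n := (Fintype.card ι : ℝ)
  set e := residual θ a z y w
  have hmove (r : F) : w' r - w r = -(η • filterGrad θ a z e w r) := by rw [hstep]; abel
  have hcoord (i : ι) : |(residual θ a z y w' - (e - η • tangentKernel θ a z w e)) i| ≤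
      η * (√n * ‖e‖) * (lam / (8 * n)) := by
    calc |(residual θ a z y w' - (e - η • tangentKernel θ a z w e)) i|
        = |residual θ a z y w' i - e i -
            ∑ r, θ * a r * ⟪avgReluGrad (z i) (w r), w' r - w r⟫| := by
          simp only [hmove, PiLp.sub_apply, PiLp.smul_apply, tangentKernel, inner_neg_right,
            real_inner_smul_right, smul_eq_mul, mul_neg, Finset.sum_neg_distrib, Finset.mul_sum,
            mul_left_comm _ η, sub_neg_eq_add]
          congr 1; ring
      _ ≤ ∑ r, θ * (unstableFrac R (z i) (w₀ r) * ‖w' r - w r‖) :=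
          abs_residual_sub_linear_le hz hθ ha y hw hw' i
      _ ≤ ∑ r, θ * (unstableFrac R (z i) (w₀ r) * (η * (θ * (√n * ‖e‖)))) := by
          gcongr with r
          · exact unstableFrac_nonneg _ _ _
          · rw [hmove, norm_neg, norm_smul, Real.norm_of_nonneg hη]
            gcongr
            exact norm_filterGrad_le hz hθ ha e w r
      _ = η * (√n * ‖e‖) * (θ ^ 2 * ∑ r, unstableFrac R (z i) (w₀ r)) := by
          simp only [Finset.mul_sum]
          exact Finset.sum_congr rfl fun r _ => by ring
      _ ≤ η * (√n * ‖e‖) * (lam / (8 * n)) := by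
          gcongr
          exact h.unstable_le i
  calc _ ≤ √n * (η * (√n * ‖e‖) * (lam / (8 * n))) :=
        norm_le_sqrt_card_mul (by positivity) hcoord
    _ = η * ‖e‖ * (√n * √n * (lam / (8 * n))) := by ring
    _ ≤ η * ‖e‖ * (lam / 8) := by
        rw [Real.mul_self_sqrt (by positivity)]
        gcongr
        exact natCast_mul_div_mul_le hlam (by norm_num) _
    _ = η * lam / 8 * ‖e‖ := by ring

lemma WellSpread.norm_residual_le (hθF : θ ^ 2 * Fintype.card F ≤ 1)
    (hηn : η * Fintype.card ι ^ 2 ≤ lam / 2) (hηlam : η * lam ≤ 1) :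
    ‖residual θ a z y w'‖ ≤ (1 - η * lam / 8) * ‖residual θ a z y w‖ := by
  set e := residual θ a z y w
  have hlinear : ‖e - η • tangentKernel θ a z w e‖ ≤ (1 - η * (lam / 2) / 2) * ‖e‖ :=
    norm_sub_smul_le_of_le_inner hη (h.inner_tangentKernel_ge hlam ha hz hw e)
      (norm_tangentKernel_le hz hθ hθF ha e w) hηn (by linarith)
  have herror : ‖residual θ a z y w' - (e - η • tangentKernel θ a z w e)‖ ≤
      η * lam / 8 * ‖e‖ :=
    h.norm_residual_sub_tangentKernel_le hθ hlam hη ha hz hw hw' hstep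
  linarith [norm_le_norm_add_norm_sub' (residual θ a z y w') (e - η • tangentKernel θ a z w e)]

end Step

-- While the filters stay within `R`, the errors decay geometrically, so that the gradient steps
-- sum up to a geometric series whose total is at most `R`.
lemma LazyInit.norm_sub_init_le {w : ℕ → F → V} (h : LazyInit θ lam R z y a (w 0)) (hθ : 0 ≤ θ)
    (hθF : θ ^ 2 * Fintype.card F ≤ 1) (hlam : 0 < lam) (hη : 0 ≤ η)
    (hηn : η * Fintype.card ι ^ 2 ≤ lam / 2) (hηlam : η * lam ≤ 1) (hz : ∀ i j, ‖z i j‖ = 1)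
    (hstep : ∀ t r, w (t + 1) r = w t r - η • filterGrad θ a z (residual θ a z y (w t)) (w t) r)
    (t : ℕ) (r : F) : ‖w t r - w 0 r‖ ≤ R := by
  set n := (Fintype.card ι : ℝ)
  set S := ‖residual θ a z y (w 0)‖
  set ρ := 1 - η * lam / 8 with hρ
  set A := 8 * √n * θ * S / lam with hA
  have hρ0 : 0 ≤ ρ := by linarith
  have hbound (t : ℕ) : A * (1 - ρ ^ t) ≤ R := by
    have hAR : A ≤ R := (div_le_iff₀' hlam).mpr h.residual_le
    exact (mul_le_of_le_one_right (by positivity) (by linarith [pow_nonneg hρ0 t])).trans hAR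
  suffices H : ∀ t, ‖residual θ a z y (w t)‖ ≤ ρ ^ t * S ∧
      ∀ r, ‖w t r - w 0 r‖ ≤ A * (1 - ρ ^ t) from ((H t).2 r).trans (hbound t)
  intro t
  induction t with
  | zero => simp [S]
  | succ t ih =>
    obtain ⟨hres, hmove⟩ := ih
    have hmove' (r : F) : ‖w (t + 1) r - w 0 r‖ ≤ A * (1 - ρ ^ (t + 1)) := by
      calc ‖w (t + 1) r - w 0 r‖ = ‖(w t r - w 0 r) -
            η • filterGrad θ a z (residual θ a z y (w t)) (w t) r‖ := by
            rw [hstep, sub_right_comm]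
        _ ≤ A * (1 - ρ ^ t) + η * (θ * (√n * (ρ ^ t * S))) := by
            refine (norm_sub_le _ _).trans (add_le_add (hmove r) ?_)
            rw [norm_smul, Real.norm_of_nonneg hη]
            gcongr
            exact (norm_filterGrad_le hz hθ h.abs_sign _ _ _).trans (by gcongr)
        _ = A * (1 - ρ ^ (t + 1)) := by
            rw [pow_succ, hρ, hA]
            field_simp
            ring
    refine ⟨?_, hmove'⟩
    calc ‖residual θ a z y (w (t + 1))‖ ≤ ρ * ‖residual θ a z y (w t)‖ :=
          h.norm_residual_le hθ hlam.le hη h.abs_sign hz (fun r => (hmove r).trans (hbound t))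
            (fun r => (hmove' r).trans (hbound (t + 1))) (hstep t) hθF hηn hηlam
      _ ≤ ρ * (ρ ^ t * S) := by gcongr
      _ = ρ ^ (t + 1) * S := by ring

end LazyTraining

section Chebyshev

variable {F E : Type*} [Fintype F] [MeasurableSpace E] {μ : Measure E} [IsProbabilityMeasure μ]

lemma measureReal_pi_abs_sum_sub_ge_le {φ : E → ℝ} (hφ : MemLp φ 2 μ) (b : ℝ) {t : ℝ}
    (ht : 0 < t) :
    (Measure.pi fun _ : F => μ).real
        {v | t ≤ |b * ∑ r, φ (v r) - b * Fintype.card F * ∫ x, φ x ∂μ|} ≤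
      b ^ 2 * Fintype.card F * Var[φ; μ] / t ^ 2 := by
  have hcomp (r : F) : MemLp (fun v : F → E => φ (v r)) 2 (Measure.pi fun _ : F => μ) :=
    hφ.comp_measurePreserving (measurePreserving_eval (fun _ : F => μ) r)
  have hmean : ∫ v, b * ∑ r, φ (v r) ∂(Measure.pi fun _ : F => μ) =
      b * Fintype.card F * ∫ x, φ x ∂μ := by
    rw [integral_const_mul, integral_finsetSum _ fun r _ => (hcomp r).integrable one_le_two]
    simp only [integral_comp_eval (μ := fun _ : F => μ) hφ.1, Finset.sum_const, Finset.card_univ,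
      nsmul_eq_mul, mul_assoc]
  have hvar : Var[fun v : F → E => b * ∑ r, φ (v r); Measure.pi fun _ : F => μ] =
      b ^ 2 * Fintype.card F * Var[φ; μ] := by
    rw [variance_const_mul, show (fun v : F → E => ∑ r, φ (v r)) = ∑ r, fun v => φ (v r) by
      ext; simp only [Finset.sum_apply], variance_sum_pi fun _ => hφ]
    simp only [Finset.sum_const, Finset.card_univ, nsmul_eq_mul, mul_assoc]
  have h := meas_ge_le_variance_div_sq
    ((memLp_finsetSum Finset.univ fun r _ => hcomp r).const_mul b) ht
  rw [hmean, hvar] at h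
  refine ENNReal.toReal_le_of_le_ofReal ?_ h
  have := variance_nonneg φ μ
  positivity

lemma measureReal_pi_abs_sum_sub_ge_le_of_abs_le_one {φ : E → ℝ} (hm : Measurable φ)
    (h : ∀ x, |φ x| ≤ 1) {b : ℝ} (hb : 0 ≤ b) (hbF : b * Fintype.card F ≤ 1) {t : ℝ}
    (ht : 0 < t) :
    (Measure.pi fun _ : F => μ).real
        {v | t ≤ |b * ∑ r, φ (v r) - b * Fintype.card F * ∫ x, φ x ∂μ|} ≤ b / t ^ 2 := by
  have hvar : Var[φ; μ] ≤ 1 := by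
    simpa using variance_le_sq_of_bounded (μ := μ) (X := φ) (a := -1) (b := 1)
      (.of_forall fun x => abs_le.mp (h x)) hm.aemeasurable
  refine (measureReal_pi_abs_sum_sub_ge_le (.of_bound hm.aestronglyMeasurable 1 (.of_forall h)) b
    ht).trans ?_
  gcongr
  have := variance_nonneg φ μ
  calc b ^ 2 * Fintype.card F * Var[φ; μ] = b * (b * Fintype.card F) * Var[φ; μ] := by ring
    _ ≤ b * 1 * 1 := by gcongr
    _ = b := by ring

end Chebyshev

section SignLaw

/-- The law of one uniform sign. -/
def signLaw : Measure ℝ := uniformOn {-1, 1}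

instance : IsProbabilityMeasure signLaw :=
  isProbabilityMeasure_uniformOn (by simp) (by simp)

lemma ae_signLaw_mem : ∀ᵐ x ∂signLaw, x ∈ ({-1, 1} : Finset ℝ) := by
  have h : ∀ᵐ x ∂signLaw, x ∈ ({-1, 1} : Set ℝ) := ae_cond_mem (by measurability)
  simpa using h

lemma ae_signLaw_abs : ∀ᵐ x ∂signLaw, |x| = 1 := by
  filter_upwards [ae_signLaw_mem] with x hx
  rcases Finset.mem_insert.mp hx with rfl | hx
  · norm_num
  · simp [Finset.mem_singleton.mp hx]

lemma integral_signLaw : ∫ x, x ∂signLaw = 0 := by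
  have hsymm : signLaw {-1} = signLaw {1} := by
    have h (x : ℝ) := uniformOn_apply_finset (Ω := ℝ) (s := {-1, 1}) (t := {x})
    have h₁ := h (-1)
    have h₂ := h 1
    push_cast at h₁ h₂
    rw [signLaw, h₁, h₂, Finset.inter_eq_right.mpr (by simp), Finset.inter_eq_right.mpr (by simp)]
    simp only [Finset.card_singleton]
  rw [← Measure.restrict_eq_self_of_ae_mem ae_signLaw_mem, setIntegral_finset _ .finset,
    Finset.sum_pair (by norm_num)]
  simp [Measure.real, hsymm]

lemma memLp_id_signLaw : MemLp (fun x => x) 2 signLaw :=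
  .of_bound (by fun_prop) 1 (ae_signLaw_abs.mono fun _ h => h.le)

lemma integral_sq_signLaw : ∫ x, x ^ 2 ∂signLaw = 1 := by
  have h : (fun x => x ^ 2) =ᵐ[signLaw] fun _ => 1 := by
    filter_upwards [ae_signLaw_abs] with x hx
    rw [← sq_abs, hx, one_pow]
  simpa using integral_congr_ae h

variable {E : Type*} [MeasurableSpace E] {μ : Measure E} {f : E → ℝ}

lemma memLp_sign_mul (hf : MemLp f 2 μ) :
    MemLp (fun v : ℝ × E => v.1 * f v.2) 2 (signLaw.prod μ) := by
  refine (memLp_two_iff_integrable_sq (memLp_id_signLaw.1.comp_fst.mul hf.1.comp_snd)).mpr ?_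
  simpa only [Pi.mul_apply, mul_pow] using memLp_id_signLaw.integrable_sq.mul_prod hf.integrable_sq

variable [SFinite μ]

lemma integral_sign_mul (f : E → ℝ) : ∫ v : ℝ × E, v.1 * f v.2 ∂(signLaw.prod μ) = 0 := by
  rw [integral_prod_mul (fun x => x) f, integral_signLaw, zero_mul]

lemma variance_sign_mul (hf : MemLp f 2 μ) :
    Var[fun v : ℝ × E => v.1 * f v.2; signLaw.prod μ] = ∫ x, f x ^ 2 ∂μ := by
  rw [variance_of_integral_eq_zero (memLp_sign_mul hf).1.aemeasurable (integral_sign_mul f)]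
  simp only [mul_pow]
  rw [integral_prod_mul (fun x => x ^ 2) (fun x => f x ^ 2), integral_sq_signLaw, one_mul]

end SignLaw

section Gaussian

lemma integral_sq_gaussianReal : ∫ x, x ^ 2 ∂(gaussianReal 0 1) = 1 := by
  simpa [variance_eq_integral (measurable_id'.aemeasurable)] using
    variance_fun_id_gaussianReal (μ := 0) (v := 1)

lemma memLp_sq_gaussianReal : MemLp (fun x => x ^ 2) 2 (gaussianReal 0 1) := by
  refine (memLp_two_iff_integrable_sq (by fun_prop)).mpr ?_
  simpa only [id, Real.norm_eq_abs, Even.pow_abs (by decide : Even 4), ← pow_mul] using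
    (memLp_id_gaussianReal (μ := 0) (v := 1) 4).integrable_norm_pow (p := 4) (by norm_num)

lemma gaussianPDFReal_le_half (x : ℝ) : gaussianPDFReal 0 1 x ≤ 1 / 2 := by
  have hsqrt : 2 ≤ √(2 * Real.pi * (1 : NNReal)) := by
    refine Real.le_sqrt_of_sq_le ?_
    push_cast
    linarith [Real.pi_gt_three]
  calc gaussianPDFReal 0 1 x ≤ (√(2 * Real.pi * (1 : NNReal)))⁻¹ * 1 := by
        unfold gaussianPDFReal
        gcongr
        exact Real.exp_le_one_iff.mpr (div_nonpos_of_nonpos_of_nonneg (by nlinarith) (by simp))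
    _ ≤ 1 / 2 := by
        rw [mul_one, one_div]
        gcongr

lemma gaussianReal_abs_le_le {R : ℝ} (hR : 0 ≤ R) : (gaussianReal 0 1).real {x | |x| ≤ R} ≤ R := by
  refine ENNReal.toReal_le_of_le_ofReal hR ?_
  rw [gaussianReal_apply 0 one_ne_zero, show {x : ℝ | |x| ≤ R} = Set.Icc (-R) R by
    ext; simp [abs_le]]
  calc ∫⁻ x in Set.Icc (-R) R, gaussianPDF 0 1 x
      ≤ ∫⁻ _ in Set.Icc (-R) R, ENNReal.ofReal (1 / 2) :=
        lintegral_mono fun x => ENNReal.ofReal_le_ofReal (gaussianPDFReal_le_half x)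
    _ = ENNReal.ofReal R := by
        rw [setLIntegral_const, Real.volume_Icc, ← ENNReal.ofReal_mul (by norm_num)]
        congr 1
        ring

/-- The variance of the square of a standard Gaussian variable. -/
def gaussianSqVar : ℝ := Var[fun x : ℝ => x ^ 2; gaussianReal 0 1]

lemma stdGaussian_abs_norm_sq_sub_ge_le {κ : Type*} [Fintype κ] {t : ℝ} (ht : 0 < t) :
    (stdGaussian (EuclideanSpace ℝ κ)).real {w | t ≤ |‖w‖ ^ 2 - Fintype.card κ|} ≤
      Fintype.card κ * gaussianSqVar / t ^ 2 := by
  have h := measureReal_pi_abs_sum_sub_ge_le (F := κ) memLp_sq_gaussianReal 1 ht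
  rw [integral_sq_gaussianReal] at h
  simp only [one_mul, mul_one, one_pow] at h
  rw [← map_pi_eq_stdGaussian, map_measureReal_apply (WithLp.measurable_toLp 2 _)
    (measurableSet_le measurable_const (by fun_prop))]
  simpa only [gaussianSqVar, Set.preimage_ofPred_eq, EuclideanSpace.real_norm_sq_eq] using h

lemma abs_sub_sqrt_mul_sqrt_le {u b : ℝ} (hu : 0 ≤ u) (hb : 0 ≤ b) :
    |u - √b| * √b ≤ |u ^ 2 - b| :=
  calc |u - √b| * √b ≤ |u - √b| * |u + √b| := by
        gcongr
        exact (le_add_of_nonneg_left hu).trans (le_abs_self _)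
    _ = |u ^ 2 - b| := by rw [← abs_mul, mul_comm, ← sq_sub_sq, Real.sq_sqrt hb]

lemma stdGaussian_abs_norm_sub_sqrt_gt_le {κ : Type*} [Fintype κ] {t : ℝ} (ht : 0 < t) :
    (stdGaussian (EuclideanSpace ℝ κ)).real {w | t < |‖w‖ - √(Fintype.card κ)|} ≤
      gaussianSqVar / t ^ 2 := by
  rcases isEmpty_or_nonempty κ with hκ | hκ
  · have hempty : {w : EuclideanSpace ℝ κ | t < |‖w‖ - √(Fintype.card κ)|} = ∅ := by
      ext w
      simp [Subsingleton.elim w 0, ht.le]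
    rw [hempty, measureReal_empty]
    exact div_nonneg (variance_nonneg _ _) (sq_nonneg t)
  have hκ0 : 0 < √(Fintype.card κ : ℝ) := Real.sqrt_pos.mpr (by exact_mod_cast Fintype.card_pos)
  calc (stdGaussian (EuclideanSpace ℝ κ)).real {w | t < |‖w‖ - √(Fintype.card κ)|}
      ≤ (stdGaussian (EuclideanSpace ℝ κ)).real
          {w | t * √(Fintype.card κ) ≤ |‖w‖ ^ 2 - Fintype.card κ|} :=
        measureReal_mono fun w (hw : t < _) => (mul_le_mul_of_nonneg_right hw.le hκ0.le).trans
          (abs_sub_sqrt_mul_sqrt_le (norm_nonneg w) (by positivity))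
    _ ≤ Fintype.card κ * gaussianSqVar / (t * √(Fintype.card κ)) ^ 2 :=
        stdGaussian_abs_norm_sq_sub_ge_le (by positivity)
    _ = gaussianSqVar / t ^ 2 := by
        rw [mul_pow, Real.sq_sqrt (by positivity)]
        field_simp

variable {V : Type*} [NormedAddCommGroup V] [InnerProductSpace ℝ V] [FiniteDimensional ℝ V]
  [MeasurableSpace V] [BorelSpace V]

lemma stdGaussian_map_inner {u : V} (hu : ‖u‖ = 1) :
    (stdGaussian V).map (fun w => ⟪w, u⟫) = gaussianReal 0 1 := by
  have h := IsGaussian.map_eq_gaussianReal (μ := stdGaussian V) (innerSL ℝ u)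
  rw [integral_strongDual_stdGaussian, variance_dual_stdGaussian, innerSL_apply_norm, hu, one_pow,
    Real.toNNReal_one] at h
  rw [← h]
  congr 1
  ext w
  rw [innerSL_apply_apply, real_inner_comm]

lemma memLp_inner_stdGaussian (u : V) : MemLp (fun w => ⟪w, u⟫) 2 (stdGaussian V) :=
  IsGaussian.memLp_two_id.inner_const u

lemma integral_inner_sq_stdGaussian {u : V} (hu : ‖u‖ = 1) :
    ∫ w, ⟪w, u⟫ ^ 2 ∂(stdGaussian V) = 1 := by
  rw [← integral_sq_gaussianReal, ← stdGaussian_map_inner hu,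
    integral_map (by fun_prop) (by fun_prop)]

lemma stdGaussian_abs_inner_le_le {u : V} (hu : ‖u‖ = 1) {R : ℝ} (hR : 0 ≤ R) :
    (stdGaussian V).real {w | |⟪w, u⟫| ≤ R} ≤ R := by
  have h := gaussianReal_abs_le_le hR
  rwa [← stdGaussian_map_inner hu, map_measureReal_apply (by fun_prop)
    (measurableSet_le (by fun_prop) measurable_const)] at h

end Gaussian

section GaussianFilter

lemma measurable_relu : Measurable relu := measurable_id.max measurable_const

lemma measurable_reluDeriv : Measurable reluDeriv :=
  Measurable.ite measurableSet_Ici measurable_const measurable_const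

variable {V : Type*} [NormedAddCommGroup V] [InnerProductSpace ℝ V] [FiniteDimensional ℝ V]
  [MeasurableSpace V] [BorelSpace V] {J : Type*} [Fintype J]

section Mean

variable {E : Type*} [MeasurableSpace E]

lemma measurable_mean {g : J → E → V} (hg : ∀ j, Measurable (g j)) :
    Measurable fun x => mean fun j => g j x :=
  (Finset.measurable_fun_sum _ fun j _ => hg j).const_smul _

variable {μ : Measure E} {g : J → E → ℝ} (hg : ∀ j, Integrable (g j) μ)
include hg

lemma integrable_mean : Integrable (fun x => mean fun j => g j x) μ :=
  (integrable_finsetSum _ fun j _ => hg j).const_mul _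

lemma integral_mean : ∫ x, mean (fun j => g j x) ∂μ = mean fun j => ∫ x, g j x ∂μ := by
  simp only [mean, integral_smul, integral_finsetSum _ fun j _ => hg j]

end Mean

lemma measurable_avgRelu (z : J → V) : Measurable (avgRelu z) :=
  measurable_mean fun j => measurable_relu.comp (by fun_prop : Measurable fun w => ⟪w, z j⟫)

lemma measurable_avgReluGrad (z : J → V) : Measurable (avgReluGrad z) :=
  measurable_mean fun j =>
    (measurable_reluDeriv.comp (by fun_prop : Measurable fun w => ⟪w, z j⟫)).smul_const _

lemma measurable_unstableFrac (R : ℝ) (z : J → V) : Measurable (unstableFrac R z) :=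
  measurable_mean fun j =>
    Measurable.ite (measurableSet_le (by fun_prop : Measurable fun w => |⟪w, z j⟫|)
      measurable_const) measurable_const measurable_const

lemma memLp_avgRelu (z : J → V) : MemLp (avgRelu z) 2 (stdGaussian V) := by
  refine (memLp_two_iff_integrable_sq (measurable_avgRelu z).aestronglyMeasurable).mpr ?_
  refine (integrable_mean fun j => (memLp_inner_stdGaussian (z j)).integrable_sq).mono'
    ((measurable_avgRelu z).pow_const 2).aestronglyMeasurable (.of_forall fun w => ?_)
  rw [Real.norm_of_nonneg (sq_nonneg _)]
  exact sq_avgRelu_le z w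

variable {z : J → V} (hz : ∀ j, ‖z j‖ = 1)
include hz

lemma integral_sq_avgRelu_le_one : ∫ w, avgRelu z w ^ 2 ∂(stdGaussian V) ≤ 1 := by
  have hint (j : J) := (memLp_inner_stdGaussian (z j)).integrable_sq
  calc ∫ w, avgRelu z w ^ 2 ∂(stdGaussian V)
      ≤ ∫ w, mean (fun j => ⟪w, z j⟫ ^ 2) ∂(stdGaussian V) :=
        integral_mono (memLp_avgRelu z).integrable_sq (integrable_mean hint) (sq_avgRelu_le z)
    _ = mean fun j => ∫ w, ⟪w, z j⟫ ^ 2 ∂(stdGaussian V) := integral_mean hint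
    _ ≤ 1 := mean_le zero_le_one fun j => (integral_inner_sq_stdGaussian (hz j)).le

lemma integral_unstableFrac_le {R : ℝ} (hR : 0 ≤ R) :
    ∫ w, unstableFrac R z w ∂(stdGaussian V) ≤ R := by
  have hset (j : J) : MeasurableSet {w : V | |⟪w, z j⟫| ≤ R} :=
    measurableSet_le (by fun_prop) measurable_const
  have hind (w : V) : unstableFrac R z w =
      mean fun j => {w : V | |⟪w, z j⟫| ≤ R}.indicator (fun _ => (1 : ℝ)) w := by
    simp only [unstableFrac, Set.indicator_apply, Set.mem_ofPred_eq]
  simp only [hind]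
  rw [integral_mean fun j => (integrable_const 1).indicator (hset j)]
  refine mean_le hR fun j => ?_
  rw [integral_indicator_const _ (hset j), smul_eq_mul, mul_one]
  exact stdGaussian_abs_inner_le_le (hz j) hR

end GaussianFilter

section QuadraticForm

open scoped Matrix

variable {ι : Type*} [Fintype ι]

lemma abs_dotProduct_mulVec_le {A : Matrix ι ι ℝ} {b : ℝ} (hb : 0 ≤ b) (hA : ∀ i i', |A i i'| ≤ b)
    (e : EuclideanSpace ℝ ι) : |e ⬝ᵥ A *ᵥ e| ≤ Fintype.card ι * b * ‖e‖ ^ 2 := by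
  calc |e ⬝ᵥ A *ᵥ e| ≤ ∑ i, ∑ i', |e i| * (b * |e i'|) := by
        simp only [dotProduct, Matrix.mulVec, Finset.mul_sum]
        refine (Finset.abs_sum_le_sum_abs _ _).trans (Finset.sum_le_sum fun i _ =>
          (Finset.abs_sum_le_sum_abs _ _).trans (Finset.sum_le_sum fun i' _ => ?_))
        rw [abs_mul, abs_mul]
        gcongr
        exact hA i i'
    _ = b * (∑ i, |e i|) ^ 2 := by
        rw [sq, Finset.sum_mul_sum, Finset.mul_sum]
        simp only [Finset.mul_sum, mul_left_comm b]
    _ ≤ b * (√(Fintype.card ι) * ‖e‖) ^ 2 := by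
        gcongr
        exact sum_abs_le_sqrt_card_mul_norm e
    _ = Fintype.card ι * b * ‖e‖ ^ 2 := by
        rw [mul_pow, Real.sq_sqrt (by positivity)]
        ring

end QuadraticForm

section RandomInit

open scoped Matrix

variable {V : Type*} [NormedAddCommGroup V] [InnerProductSpace ℝ V] [FiniteDimensional ℝ V]
  [MeasurableSpace V] [BorelSpace V] {J ι F : Type*} [Fintype J] [Fintype ι] [Fintype F]

/-- The expected Gram matrix of the gradients of the responses of a standard Gaussian filter to the
inputs with patches `z i`. -/
def reluGram (z : ι → J → V) : Matrix ι ι ℝ :=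
  Matrix.of fun i i' => ∫ w, ⟪avgReluGrad (z i) w, avgReluGrad (z i') w⟫ ∂(stdGaussian V)

section Deviation

variable {θ lam R : ℝ} {z : ι → J → V} (hz : ∀ i j, ‖z i j‖ = 1)
  (hθF : θ ^ 2 * Fintype.card F ≤ 1) (hlam : 0 < lam) (hR : 0 ≤ R)
  (hRlam : R ≤ lam / (16 * Fintype.card ι))
  (hgram : ∀ e : EuclideanSpace ℝ ι,
    lam * ‖e‖ ^ 2 ≤ θ ^ 2 * Fintype.card F * (e ⬝ᵥ reluGram z *ᵥ e))
include hz hθF hlam hR hRlam hgram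

lemma WellSpread.of_abs_sub_lt {w : F → V}
    (hgramDev : ∀ i i', |θ ^ 2 * ∑ r, ⟪avgReluGrad (z i) (w r), avgReluGrad (z i') (w r)⟫ -
      θ ^ 2 * Fintype.card F * ∫ v, ⟪avgReluGrad (z i) v, avgReluGrad (z i') v⟫ ∂(stdGaussian V)| <
        lam / (4 * Fintype.card ι))
    (hunstDev : ∀ i, |θ ^ 2 * ∑ r, unstableFrac R (z i) (w r) -
      θ ^ 2 * Fintype.card F * ∫ v, unstableFrac R (z i) v ∂(stdGaussian V)| <
        lam / (16 * Fintype.card ι)) :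
    WellSpread θ lam R z w where
  gram_ge e := by
    set A := θ ^ 2 • ∑ r, Matrix.gram ℝ fun i => avgReluGrad (z i) (w r)
    set G := (θ ^ 2 * Fintype.card F) • reluGram z
    have hA : e ⬝ᵥ A *ᵥ e = θ ^ 2 * ∑ r, ‖∑ i, e i • avgReluGrad (z i) (w r)‖ ^ 2 := by
      have hr (r : F) := Matrix.star_dotProduct_gram_mulVec (𝕜 := ℝ)
        (fun i => avgReluGrad (z i) (w r)) e e
      simp only [star_trivial, real_inner_self_eq_norm_sq] at hr
      simp only [A, Matrix.smul_mulVec, Matrix.sum_mulVec, dotProduct_smul, dotProduct_sum, hr,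
        smul_eq_mul]
    have hG : lam * ‖e‖ ^ 2 ≤ e ⬝ᵥ G *ᵥ e := by
      rw [Matrix.smul_mulVec, dotProduct_smul, smul_eq_mul]
      exact hgram e
    have hdev : |e ⬝ᵥ A *ᵥ e - e ⬝ᵥ G *ᵥ e| ≤ lam / 4 * ‖e‖ ^ 2 := by
      rw [← dotProduct_sub, ← Matrix.sub_mulVec]
      refine (abs_dotProduct_mulVec_le (b := lam / (4 * Fintype.card ι)) (by positivity)
        (fun i i' => ?_) e).trans ?_
      · simpa only [A, G, reluGram, Matrix.sub_apply, Matrix.smul_apply, Matrix.sum_apply,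
          Matrix.gram_apply, Matrix.of_apply, smul_eq_mul] using (hgramDev i i').le
      · gcongr
        exact natCast_mul_div_mul_le hlam.le (by norm_num) _
    linarith [(abs_le.mp hdev).1]
  unstable_le i := by
    have hmean : θ ^ 2 * Fintype.card F * ∫ v, unstableFrac R (z i) v ∂(stdGaussian V) ≤ R :=
      (mul_le_of_le_one_left (integral_nonneg fun v => unstableFrac_nonneg _ _ _) hθF).trans
        (integral_unstableFrac_le (hz i) hR)
    have hhalf : lam / (8 * Fintype.card ι) =
        lam / (16 * Fintype.card ι) + lam / (16 * Fintype.card ι) := by ring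
    linarith [(abs_lt.mp (hunstDev i)).2]

end Deviation

lemma measureReal_not_forall_le {E : Type*} [MeasurableSpace E] {μ : Measure E}
    {p : ι → E → Prop} {b : ℝ} (h : ∀ i, μ.real {x | ¬p i x} ≤ b) :
    μ.real {x | ¬∀ i, p i x} ≤ Fintype.card ι * b := by
  rw [show {x | ¬∀ i, p i x} = ⋃ i, {x | ¬p i x} by ext; simp]
  exact (measureReal_iUnion_fintype_le _).trans
    ((Finset.sum_le_card_nsmul _ _ b fun i _ => h i).trans_eq (by simp))

variable (V) in
/-- The law of one neuron at initialization: its output weight is a uniform sign, and its filter is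
an independent standard Gaussian vector. -/
def neuronLaw : Measure (ℝ × V) := signLaw.prod (stdGaussian V)

instance : IsProbabilityMeasure (neuronLaw V) := by
  unfold neuronLaw
  infer_instance

lemma ae_neuronLaw_abs_sign :
    ∀ᵐ v ∂(Measure.pi fun _ : F => neuronLaw V), ∀ r, |(v r).1| = 1 :=
  ae_all_iff.mpr fun r => (measurePreserving_fst.comp
    (measurePreserving_eval (fun _ : F => neuronLaw V) r)).quasiMeasurePreserving.ae ae_signLaw_abs

lemma measureReal_abs_sum_filter_sub_ge_le {φ : V → ℝ} (hm : Measurable φ) (h : ∀ x, |φ x| ≤ 1)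
    {b : ℝ} (hb : 0 ≤ b) (hbF : b * Fintype.card F ≤ 1) {t : ℝ} (ht : 0 < t) :
    (Measure.pi fun _ : F => neuronLaw V).real
        {v | ¬|b * ∑ r, φ (v r).2 - b * Fintype.card F * ∫ x, φ x ∂(stdGaussian V)| < t} ≤
      b / t ^ 2 := by
  have hφ := measureReal_pi_abs_sum_sub_ge_le_of_abs_le_one (F := F) (μ := neuronLaw V)
    (hm.comp measurable_snd) (fun v => h v.2) hb hbF ht
  simpa only [Function.comp_apply, neuronLaw, integral_fun_snd, probReal_univ, one_smul, not_lt]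
    using hφ

lemma measureReal_abs_output_ge_le {z : J → V} (hz : ∀ j, ‖z j‖ = 1) {θ : ℝ}
    (hθF : θ ^ 2 * Fintype.card F ≤ 1) {t : ℝ} (ht : 0 < t) :
    (Measure.pi fun _ : F => neuronLaw V).real
        {v | ¬|θ * ∑ r, (v r).1 * avgRelu z (v r).2| < t} ≤ 1 / t ^ 2 := by
  have h := measureReal_pi_abs_sum_sub_ge_le (F := F) (memLp_sign_mul (memLp_avgRelu z)) θ ht
  rw [integral_sign_mul, variance_sign_mul (memLp_avgRelu z)] at h
  simp only [mul_zero, sub_zero] at h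
  simp only [not_lt]
  refine h.trans ?_
  gcongr
  exact mul_le_one₀ hθF (integral_nonneg fun w => sq_nonneg _) (integral_sq_avgRelu_le_one hz)

lemma measureReal_not_lazyInit_le [Nonempty ι] {θ lam R τ : ℝ} {z : ι → J → V} {y : ι → ℝ}
    (hz : ∀ i j, ‖z i j‖ = 1) (hθ : 0 ≤ θ) (hθF : θ ^ 2 * Fintype.card F ≤ 1) (hlam : 0 < lam)
    (hR : 0 ≤ R) (hRlam : R ≤ lam / (16 * Fintype.card ι))
    (hgram : ∀ e : EuclideanSpace ℝ ι,
      lam * ‖e‖ ^ 2 ≤ θ ^ 2 * Fintype.card F * (e ⬝ᵥ reluGram z *ᵥ e))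
    (hτ : 0 < τ) (hτR : 16 * Fintype.card ι * θ * τ ≤ lam * R) (hy : ∀ i, |y i| ≤ τ) :
    (Measure.pi fun _ : F => neuronLaw V).real
        {v | ¬LazyInit θ lam R z y (fun r => (v r).1) (fun r => (v r).2)} ≤
      Fintype.card ι * (Fintype.card ι * (θ ^ 2 / (lam / (4 * Fintype.card ι)) ^ 2)) +
        Fintype.card ι * (θ ^ 2 / (lam / (16 * Fintype.card ι)) ^ 2) +
        Fintype.card ι * (1 / τ ^ 2) := by
  have : 0 < (Fintype.card ι : ℝ) := by exact_mod_cast Fintype.card_pos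
  have hgramDev := measureReal_not_forall_le fun i => measureReal_not_forall_le fun i' =>
    measureReal_abs_sum_filter_sub_ge_le (F := F)
      ((measurable_avgReluGrad (z i)).inner (measurable_avgReluGrad (z i')))
      (abs_inner_avgReluGrad_le_one (hz i) (hz i')) (sq_nonneg θ) hθF
      (by positivity : 0 < lam / (4 * Fintype.card ι))
  have hunstDev := measureReal_not_forall_le fun i =>
    measureReal_abs_sum_filter_sub_ge_le (F := F) (measurable_unstableFrac R (z i))
      (fun w => abs_le.mpr ⟨by linarith [unstableFrac_nonneg R (z i) w],
        unstableFrac_le_one R (z i) w⟩) (sq_nonneg θ) hθF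
      (by positivity : 0 < lam / (16 * Fintype.card ι))
  have hout := measureReal_not_forall_le fun i => measureReal_abs_output_ge_le (hz i) hθF hτ
  refine le_trans ?_ (add_le_add (add_le_add hgramDev hunstDev) hout)
  refine le_trans ?_ ((measureReal_union_le _ _).trans
    (add_le_add_left (measureReal_union_le _ _) _))
  refine ENNReal.toReal_mono (by finiteness) (measure_mono_ae ?_)
  filter_upwards [ae_neuronLaw_abs_sign] with v hsign hv
  change v ∈ (_ ∪ _ ∪ _ : Set (F → ℝ × V))
  by_contra hgood
  simp only [Set.mem_union, Set.mem_ofPred_eq, not_or, not_not] at hgood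
  obtain ⟨⟨hg, hu⟩, ho⟩ := hgood
  exact hv { toWellSpread := .of_abs_sub_lt hz hθF hlam hR hRlam hgram hg hu
             abs_sign := hsign
             residual_le := (residual_le_of_abs_output_lt hθ hτ.le hy ho).trans hτR }

end RandomInit

section Filters

variable {m c s : ℕ}

/-- The filter of the output channel `r` of a convolution tensor. -/
def filter (W : ConvTensor m c s) (r : Fin m) : Patch c s :=
  WithLp.toLp 2 fun kl => W (r, kl)

lemma filter_sub (W W' : ConvTensor m c s) (r : Fin m) :
    filter (W - W') r = filter W r - filter W' r := rfl

lemma norm_sq_eq_sum_filter (W : ConvTensor m c s) : ‖W‖ ^ 2 = ∑ r, ‖filter W r‖ ^ 2 := by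
  simp [EuclideanSpace.real_norm_sq_eq, filter, Fintype.sum_prod_type]

lemma norm_le_sqrt_mul_of_filter_le {W : ConvTensor m c s} {R : ℝ} (hR : 0 ≤ R)
    (hW : ∀ r, ‖filter W r‖ ≤ R) : ‖W‖ ≤ √m * R := by
  refine le_of_sq_le_sq ?_ (by positivity)
  rw [norm_sq_eq_sum_filter, mul_pow, Real.sq_sqrt (by positivity)]
  calc ∑ r, ‖filter W r‖ ^ 2 ≤ ∑ _r : Fin m, R ^ 2 := by
        gcongr with r
        exact hW r
    _ = m * R ^ 2 := by simp

lemma measurable_filter : Measurable (filter : ConvTensor m c s → Fin m → Patch c s) := by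
  refine measurable_pi_lambda _ fun r => (WithLp.measurable_toLp 2 _).comp ?_
  fun_prop

lemma stdGaussian_map_filter (m c s : ℕ) :
    (stdGaussian (ConvTensor m c s)).map filter =
      Measure.pi fun _ : Fin m => stdGaussian (Patch c s) := by
  have : IsFiniteMeasure ((stdGaussian (ConvTensor m c s)).map
    (filter : ConvTensor m c s → Fin m → Patch c s)) := by infer_instance
  refine charFun_eq_pi_iff.mp fun t => ?_
  have hinner (W : ConvTensor m c s) : ⟪WithLp.toLp 2 (filter W), t⟫ =
      ⟪W, (WithLp.toLp 2 fun rkl => t rkl.1 rkl.2 : ConvTensor m c s)⟫ := by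
    simp [PiLp.inner_apply, filter, Fintype.sum_prod_type]
  rw [Measure.map_map (WithLp.measurable_toLp 2 _) measurable_filter, charFun_apply,
    integral_map ((WithLp.measurable_toLp 2 _).comp measurable_filter).aemeasurable
      (by fun_prop)]
  simp only [Function.comp_apply, hinner]
  rw [← charFun_apply, charFun_stdGaussian]
  simp only [charFun_stdGaussian, ← Complex.exp_sum, ← Finset.sum_div, Finset.sum_neg_distrib,
    EuclideanSpace.real_norm_sq_eq, ← Complex.ofReal_pow, ← Complex.ofReal_sum,
    Fintype.sum_prod_type]

lemma measurePreserving_neurons (m c s : ℕ) :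
    MeasurePreserving (fun aW : (Fin m → ℝ) × ConvTensor m c s => fun r => (aW.1 r, filter aW.2 r))
      (initLaw m c s) (Measure.pi fun _ : Fin m => neuronLaw (Patch c s)) :=
  (measurePreserving_arrowProdEquivProdArrow ℝ (Patch c s) (Fin m) (fun _ => signLaw)
    fun _ => stdGaussian (Patch c s)).symm.comp
    ((MeasurePreserving.id (Measure.pi fun _ : Fin m => signLaw)).prod
      ⟨measurable_filter, stdGaussian_map_filter m c s⟩)

end Filters

section Network

variable {m c s D n : ℕ}

lemma conv_eq_inner (W : ConvTensor m c s) (x : Input c D) (r : Fin m) (j : ZMod D) :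
    conv W x r j = ⟪filter W r, patch s x j⟫ := by
  simp [conv, filter, patch, PiLp.inner_apply, Fintype.sum_prod_type, mul_comm]

variable [NeZero D] (N : ℕ) (a : Fin m → ℝ) (x : Fin n → Input c D) (y : Fin n → ℝ)

lemma net_eq (W : ConvTensor m c s) (x : Input c D) :
    net N a W x = 1 / √N * ∑ r, a r * avgRelu (patch s x) (filter W r) := by
  simp only [net, avgPool, avgRelu, mean, conv_eq_inner, ZMod.card, smul_eq_mul, ← one_div,
    Finset.mul_sum]
  exact Finset.sum_congr rfl fun r _ => Finset.sum_congr rfl fun j _ => by ring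

lemma residual_filter (W : ConvTensor m c s) (i : Fin n) :
    residual (1 / √N) a (fun i => patch s (x i)) y (filter W) i = net N a W (x i) - y i := by
  rw [net_eq, residual]

lemma filter_lossGrad (W : ConvTensor m c s) (r : Fin m) :
    filter (lossGrad N a x y W) r = filterGrad (1 / √N) a (fun i => patch s (x i))
      (residual (1 / √N) a (fun i => patch s (x i)) y (filter W)) (filter W) r := by
  ext kl
  simp only [filter, lossGrad, filterGrad, residual_filter, avgReluGrad, mean, PiLp.smul_apply,
    WithLp.ofLp_sum, Finset.sum_apply, smul_eq_mul, ZMod.card, conv_eq_inner, Finset.mul_sum,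
    ← one_div]
  exact Finset.sum_congr rfl fun i _ => Finset.sum_congr rfl fun j _ => by ring

lemma filter_gradDescent_succ (η : ℝ) (W : ConvTensor m c s) (t : ℕ) (r : Fin m) :
    filter (gradDescent N a x y η W (t + 1)) r = filter (gradDescent N a x y η W t) r -
      η • filterGrad (1 / √N) a (fun i => patch s (x i))
        (residual (1 / √N) a (fun i => patch s (x i)) y
          (filter (gradDescent N a x y η W t))) (filter (gradDescent N a x y η W t)) r := by
  rw [← filter_lossGrad, gradDescent, filter_sub]
  rfl

end Network

section Gram

open scoped Matrix

section ReluGram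

variable {V : Type*} [NormedAddCommGroup V] [InnerProductSpace ℝ V] [FiniteDimensional ℝ V]
  [MeasurableSpace V] {J ι : Type*} [Fintype J]

lemma isHermitian_reluGram (z : ι → J → V) : (reluGram z).IsHermitian := by
  ext i i'
  simp only [reluGram, Matrix.conjTranspose_apply, Matrix.of_apply, star_trivial, real_inner_comm]

variable [BorelSpace V]

lemma reluGram_apply_le_one {z : ι → J → V} (hz : ∀ i j, ‖z i j‖ = 1) (i i' : ι) :
    reluGram z i i' ≤ 1 := by
  have h := norm_integral_le_of_norm_le_const (μ := stdGaussian V)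
    (f := fun w => ⟪avgReluGrad (z i) w, avgReluGrad (z i') w⟫)
    (.of_forall (abs_inner_avgReluGrad_le_one (hz i) (hz i')))
  rw [probReal_univ, mul_one] at h
  exact (le_abs_self _).trans h

lemma le_one_of_mul_norm_sq_le_reluGram [Fintype ι] [Nonempty ι] {z : ι → J → V}
    (hz : ∀ i j, ‖z i j‖ = 1) {lam q : ℝ} (hq : 0 ≤ q) (hq1 : q ≤ 1)
    (h : ∀ e : EuclideanSpace ℝ ι, lam * ‖e‖ ^ 2 ≤ q * (e ⬝ᵥ reluGram z *ᵥ e)) : lam ≤ 1 := by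
  classical
  obtain ⟨i⟩ := ‹Nonempty ι›
  have hi := h (EuclideanSpace.single i 1)
  simp only [PiLp.norm_single, norm_one, one_pow, mul_one, PiLp.ofLp_single,
    single_one_dotProduct, Matrix.mulVec_single_one, Matrix.col_apply] at hi
  nlinarith [reluGram_apply_le_one hz i i]

end ReluGram

lemma gramLimit_eq_smul_reluGram {c D n s : ℕ} [NeZero D] (q : ℝ) (x : Fin n → Input c D) :
    gramLimit s q x = q • reluGram fun i => patch s (x i) := by
  ext i i'
  simp only [gramLimit, reluGram, Matrix.smul_apply, Matrix.of_apply, smul_eq_mul,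
    inner_avgReluGrad_avgReluGrad, ZMod.card, integral_const_mul]
  ring

lemma mul_norm_sq_le_of_mem_lowerBounds_eigenvalues {ι : Type*} [Fintype ι] [DecidableEq ι]
    {G : Matrix ι ι ℝ} (hG : G.IsHermitian) {lam : ℝ}
    (h : lam ∈ lowerBounds {μ : ℝ | Module.End.HasEigenvalue (Matrix.toLin' G) μ})
    (e : EuclideanSpace ℝ ι) : lam * ‖e‖ ^ 2 ≤ e ⬝ᵥ G *ᵥ e := by
  have hshift : (G - algebraMap ℝ _ lam).IsHermitian :=
    hG.sub ((IsSelfAdjoint.all lam).algebraMap _)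
  have hpos : (G - algebraMap ℝ _ lam).PosSemidef := by
    refine hshift.posSemidef_iff_eigenvalues_nonneg.mpr fun i => ?_
    have hmem := hshift.eigenvalues_mem_spectrum_real i
    rw [← spectrum.sub_singleton_eq] at hmem
    obtain ⟨μ, hμ, _, rfl, hi⟩ := hmem
    rw [← Matrix.spectrum_toLin', ← Module.End.hasEigenvalue_iff_mem_spectrum] at hμ
    simp only [← hi, Pi.zero_apply, sub_nonneg]
    exact h hμ
  have hquad := hpos.dotProduct_mulVec_nonneg e.ofLp
  rw [Algebra.algebraMap_eq_smul_one, star_trivial, Matrix.sub_mulVec, Matrix.smul_mulVec,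
    Matrix.one_mulVec, dotProduct_sub, dotProduct_smul, smul_eq_mul, sub_nonneg] at hquad
  rwa [← real_inner_self_eq_norm_sq, EuclideanSpace.inner_eq_star_dotProduct, star_trivial]

end Gram

lemma measureReal_preimage_le_of_hasLaw {Ω X : Type*} [MeasurableSpace Ω] [MeasurableSpace X]
    {P : Measure Ω} {μ : Measure X} [IsFiniteMeasure μ] {f : Ω → X} (hf : HasLaw f μ P)
    (S : Set X) : P.real (f ⁻¹' S) ≤ μ.real S :=
  ENNReal.toReal_mono (measure_ne_top μ S)
    ((Measure.le_map_apply hf.aemeasurable S).trans_eq (by rw [hf.map_eq]))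

/-- The width from which the trained norms are close to their expected initial size, up to the
factor `(n / lam) ^ 5 / δ ^ 2`. -/
def widthConst (B tol : ℝ) : ℝ :=
  2 * (272 + (1024 + 4 * gaussianSqVar) / tol ^ 2) + 1024 * B ^ 2 / tol ^ 2

lemma gaussianSqVar_nonneg : 0 ≤ gaussianSqVar := variance_nonneg _ _

lemma widthConst_pos (B tol : ℝ) : 0 < widthConst B tol := by
  have := gaussianSqVar_nonneg
  unfold widthConst
  positivity

section WidthBounds

variable {B tol lam n N δ : ℝ}

lemma pow_div_pow_le_pow_div (hn : 1 ≤ n) (hlam : 0 < lam) (hlam1 : lam ≤ 1) {a b k : ℕ}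
    (ha : a ≤ k) (hb : b ≤ k) : n ^ a / lam ^ b ≤ (n / lam) ^ k := by
  rw [div_pow]
  exact div_le_div₀ (by positivity) (pow_le_pow_right₀ hn ha) (by positivity)
    (pow_le_pow_of_le_one hlam.le hlam1 hb)

lemma pos_of_widthConst_le (hn : 0 < n) (hlam : 0 < lam) (hδ : 0 < δ)
    (h : widthConst B tol * (n / lam) ^ 5 / δ ^ 2 ≤ N) : 0 < N :=
  (div_pos (mul_pos (widthConst_pos B tol) (by positivity)) (by positivity)).trans_le h

variable (hn : 1 ≤ n) (hlam : 0 < lam) (hlam1 : lam ≤ 1) (hδ : 0 < δ) (hδ1 : δ < 1)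
  (h : widthConst B tol * (n / lam) ^ 5 / δ ^ 2 ≤ N)
include hn hlam hlam1 hδ hδ1 h

lemma label_le_of_widthConst_le (htol : 0 < tol) :
    B ≤ lam * (tol / 2 * lam / n) / (16 * n * (1 / √N)) := by
  have hn0 : 0 < n := by linarith
  have hC := widthConst_pos B tol
  have hv := gaussianSqVar_nonneg
  have hN : 0 < N := pos_of_widthConst_le hn0 hlam hδ h
  have hsq : (32 * n ^ 2 * B / (tol * lam ^ 2)) ^ 2 ≤ N :=
    calc (32 * n ^ 2 * B / (tol * lam ^ 2)) ^ 2
        = 1024 * B ^ 2 / tol ^ 2 * (n ^ 4 / lam ^ 4) := by field_simp; ring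
      _ ≤ widthConst B tol * (n / lam) ^ 5 := by
          gcongr
          · exact le_add_of_nonneg_left (by positivity)
          · exact pow_div_pow_le_pow_div hn hlam hlam1 (by norm_num) (by norm_num)
      _ ≤ widthConst B tol * (n / lam) ^ 5 / δ ^ 2 :=
          le_div_self (by positivity) (by positivity) (pow_le_one₀ hδ.le hδ1.le)
      _ ≤ N := h
  calc B = 32 * n ^ 2 * B / (tol * lam ^ 2) * (tol * lam ^ 2 / (32 * n ^ 2)) := by field_simp
    _ ≤ √N * (tol * lam ^ 2 / (32 * n ^ 2)) := by
        gcongr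
        exact Real.le_sqrt_of_sq_le hsq
    _ = lam * (tol / 2 * lam / n) / (16 * n * (1 / √N)) := by
        field_simp
        norm_num

lemma failure_le_of_widthConst_le :
    (16 * (n ^ 4 / lam ^ 2) + 256 * (n ^ 3 / lam ^ 2) + 1024 / tol ^ 2 * (n ^ 5 / lam ^ 4) +
      4 * gaussianSqVar / tol ^ 2) / N ≤ δ / 2 := by
  have hn0 : 0 < n := by linarith
  have hv := gaussianSqVar_nonneg
  set T := (n / lam) ^ 5
  have : 0 < T := by positivity
  have hN : 0 < N := pos_of_widthConst_le hn0 hlam hδ h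
  have hpow {a b : ℕ} (ha : a ≤ 5) (hb : b ≤ 5) : n ^ a / lam ^ b ≤ T :=
    pow_div_pow_le_pow_div hn hlam hlam1 ha hb
  have hT1 : 1 ≤ T := by simpa using hpow (Nat.zero_le 5) (Nat.zero_le 5)
  rw [div_le_iff₀ hN]
  calc 16 * (n ^ 4 / lam ^ 2) + 256 * (n ^ 3 / lam ^ 2) + 1024 / tol ^ 2 * (n ^ 5 / lam ^ 4) +
        4 * gaussianSqVar / tol ^ 2
      ≤ 16 * T + 256 * T + 1024 / tol ^ 2 * T + 4 * gaussianSqVar / tol ^ 2 * T := by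
        gcongr
        · exact hpow (by norm_num) (by norm_num)
        · exact hpow (by norm_num) (by norm_num)
        · exact hpow (by norm_num) (by norm_num)
        · exact le_mul_of_one_le_right (by positivity) hT1
    _ = 2 * (272 + (1024 + 4 * gaussianSqVar) / tol ^ 2) * T / 2 := by ring
    _ ≤ widthConst B tol * T / 2 := by
        gcongr
        exact le_add_of_nonneg_right (by positivity)
    _ ≤ N * δ ^ 2 / 2 := by
        have := (div_le_iff₀ (by positivity)).mp h
        gcongr ?_ / 2
    _ ≤ δ / 2 * N := by
        have : δ ^ 2 ≤ δ := by nlinarith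
        nlinarith

end WidthBounds

section TrainedNorm

open scoped Matrix

variable {m c D s n N : ℕ} [NeZero D] {x : Fin n → Input c D} {y : Fin n → ℝ} {lam : ℝ}

lemma norm_gradDescent_sub_le_of_lazyInit {R η : ℝ} {a : Fin m → ℝ} {W : ConvTensor m c s}
    (h : LazyInit (1 / √N) lam R (fun i => patch s (x i)) y a (filter W)) (hN : 0 < N)
    (hm : m ≤ N) (hx : ∀ i j, ‖patch s (x i) j‖ = 1) (hn : 0 < n) (hlam : 0 < lam)
    (hlam1 : lam ≤ 1) (hR : 0 ≤ R) (hη : 0 < η) (hηn : η ≤ 1 / 2 * lam / n ^ 2) (t : ℕ) :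
    ‖gradDescent N a x y η W t - W‖ ≤ √m * R := by
  have hn1 : (1 : ℝ) ≤ n ^ 2 := one_le_pow₀ (by exact_mod_cast hn)
  have hηn' : η * n ^ 2 ≤ 1 / 2 * lam := (le_div_iff₀ (by positivity)).mp hηn
  refine norm_le_sqrt_mul_of_filter_le hR fun r => ?_
  refine LazyInit.norm_sub_init_le (w := fun t => filter (gradDescent N a x y η W t)) (η := η)
    h (by positivity) ?_ hlam hη.le ?_ ?_ hx (filter_gradDescent_succ N a x y η W) t r
  · rw [div_pow, Real.sq_sqrt (by positivity), one_pow, Fintype.card_fin, one_div_mul_eq_div]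
    exact div_le_one_of_le₀ (by exact_mod_cast hm) (by positivity)
  · rw [Fintype.card_fin]
    linarith
  · nlinarith

lemma abs_norm_gradDescent_sub_le {tol η : ℝ} {a : Fin m → ℝ} {W : ConvTensor m c s}
    (h : LazyInit (1 / √N) lam (tol / 2 * lam / n) (fun i => patch s (x i)) y a (filter W))
    (hN : 0 < N) (hm : m ≤ N) (hx : ∀ i j, ‖patch s (x i) j‖ = 1) (hn : 0 < n) (hlam : 0 < lam)
    (hlam1 : lam ≤ 1) (htol : 0 < tol) (hη : 0 < η) (hηn : η ≤ 1 / 2 * lam / n ^ 2) {b : ℝ}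
    (hW : |‖W‖ - b| ≤ tol / 2 * √N) (t : ℕ) :
    |‖gradDescent N a x y η W t‖ - b| ≤ tol * √N := by
  have hn1 : (1 : ℝ) ≤ n := by exact_mod_cast hn
  have hR : tol / 2 * lam / n ≤ tol / 2 := by
    rw [mul_div_assoc]
    exact mul_le_of_le_one_right (by positivity) ((div_le_one (by positivity)).mpr (by linarith))
  calc |‖gradDescent N a x y η W t‖ - b|
      ≤ |‖gradDescent N a x y η W t‖ - ‖W‖| + |‖W‖ - b| := abs_sub_le _ _ _
    _ ≤ √m * (tol / 2 * lam / n) + tol / 2 * √N := by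
        gcongr
        exact (abs_norm_sub_norm_le _ _).trans (norm_gradDescent_sub_le_of_lazyInit h hN hm hx hn
          hlam hlam1 (by positivity) hη hηn t)
    _ ≤ √N * (tol / 2) + tol / 2 * √N := by gcongr
    _ = tol * √N := by ring

variable {Ω : Type*} [MeasurableSpace Ω] {P : Measure Ω} {a : Ω → Fin m → ℝ}
  {W : Ω → ConvTensor m c s} (hlaw : HasLaw (fun ω => (a ω, W ω)) (initLaw m c s) P)
include hlaw

lemma measureReal_abs_norm_init_sub_gt_le {t : ℝ} (ht : 0 < t) :
    P.real {ω | t < |‖W ω‖ - √(m * (c * (2 * s + 1)))|} ≤ gaussianSqVar / t ^ 2 := by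
  have hW : HasLaw W (stdGaussian (ConvTensor m c s)) P :=
    (measurePreserving_snd (μ := Measure.pi fun _ : Fin m => signLaw)).hasLaw.comp hlaw
  refine (measureReal_preimage_le_of_hasLaw hW
    {W | t < |‖W‖ - √(m * (c * (2 * s + 1)))|}).trans ?_
  simpa using stdGaussian_abs_norm_sub_sqrt_gt_le (κ := Fin m × Fin c × Fin (2 * s + 1)) ht

lemma measureReal_not_lazyInit_initLaw_le {B tol : ℝ} (hN : 0 < N) (hm : m ≤ N)
    (hx : ∀ i j, ‖patch s (x i) j‖ = 1) (hn : 0 < n) (hy : ∀ i, |y i| ≤ B) (hlam : 0 < lam)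
    (htol : 0 < tol) (htol1 : tol ≤ 1 / 8)
    (hgram : ∀ e : EuclideanSpace ℝ (Fin n),
      lam * ‖e‖ ^ 2 ≤ m / N * (e ⬝ᵥ (reluGram fun i => patch s (x i)) *ᵥ e))
    (hB : B ≤ lam * (tol / 2 * lam / n) / (16 * n * (1 / √N))) :
    P.real {ω | ¬LazyInit (1 / √N) lam (tol / 2 * lam / n) (fun i => patch s (x i)) y (a ω)
        (filter (W ω))} ≤
      (16 * (n ^ 4 / lam ^ 2) + 256 * (n ^ 3 / lam ^ 2) + 1024 / tol ^ 2 * (n ^ 5 / lam ^ 4)) /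
        N := by
  have : Nonempty (Fin n) := ⟨⟨0, hn⟩⟩
  have hθ : (1 / √(N : ℝ)) ^ 2 = 1 / N := by
    rw [div_pow, Real.sq_sqrt (by positivity), one_pow]
  have hlazy := measureReal_not_lazyInit_le (F := Fin m) (θ := 1 / √N) (lam := lam)
    (R := tol / 2 * lam / n) (τ := lam * (tol / 2 * lam / n) / (16 * n * (1 / √N))) (y := y)
    hx (by positivity) ?_ hlam (by positivity) ?_ ?_ (by positivity) ?_
    fun i => (hy i).trans hB
  · refine ((measureReal_preimage_le_of_hasLaw
      ((measurePreserving_neurons m c s).hasLaw.comp hlaw) _).trans hlazy).trans_eq ?_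
    rw [hθ, Fintype.card_fin]
    field_simp
    rw [Real.sq_sqrt (by positivity)]
    ring
  · rw [hθ, Fintype.card_fin, one_div_mul_eq_div]
    exact div_le_one_of_le₀ (by exact_mod_cast hm) (by positivity)
  · rw [Fintype.card_fin, div_le_div_iff₀ (by positivity) (by positivity)]
    nlinarith [mul_pos hlam (by exact_mod_cast hn : (0 : ℝ) < n)]
  · rw [hθ, Fintype.card_fin, one_div_mul_eq_div]
    exact hgram
  · rw [Fintype.card_fin, mul_div_cancel₀ _ (by positivity)]

lemma measureReal_not_abs_norm_gradDescent_sub_le [IsFiniteMeasure P] {B tol δ η : ℝ} (hm : m ≤ N)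
    (hx : ∀ i j, ‖patch s (x i) j‖ = 1) (hn : 0 < n) (hy : ∀ i, |y i| ≤ B) (hlam : 0 < lam)
    (htol : 0 < tol) (htol1 : tol ≤ 1 / 8)
    (hgram : ∀ e : EuclideanSpace ℝ (Fin n),
      lam * ‖e‖ ^ 2 ≤ m / N * (e ⬝ᵥ (reluGram fun i => patch s (x i)) *ᵥ e))
    (hδ : 0 < δ) (hδ1 : δ < 1) (hN : widthConst B tol * (n / lam) ^ 5 / δ ^ 2 ≤ N)
    (hη : 0 < η) (hηn : η ≤ 1 / 2 * lam / n ^ 2) :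
    P.real {ω | ¬∀ t, |‖gradDescent N (a ω) x y η (W ω) t‖ - √(m * (c * (2 * s + 1)))| ≤
      tol * √N} ≤ δ / 2 := by
  have : Nonempty (Fin n) := ⟨⟨0, hn⟩⟩
  have hn1 : (1 : ℝ) ≤ n := by exact_mod_cast hn
  have hN0 : 0 < N := Nat.cast_pos.mp (pos_of_widthConst_le (by positivity) hlam hδ hN)
  have hlam1 : lam ≤ 1 := le_one_of_mul_norm_sq_le_reluGram hx (by positivity)
    (div_le_one_of_le₀ (by exact_mod_cast hm) (by positivity)) hgram
  have hlazy := measureReal_not_lazyInit_initLaw_le hlaw hN0 hm hx hn hy hlam htol htol1 hgram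
    (label_le_of_widthConst_le hn1 hlam hlam1 hδ hδ1 hN htol)
  have hnorm := measureReal_abs_norm_init_sub_gt_le hlaw (by positivity : 0 < tol / 2 * √N)
  refine (measureReal_mono ?_ (by finiteness)).trans ((measureReal_union_le _ _).trans
    ((add_le_add hlazy hnorm).trans (le_of_eq_of_le ?_
      (failure_le_of_widthConst_le hn1 hlam hlam1 hδ hδ1 hN))))
  · intro ω hω
    by_contra hgood
    simp only [Set.mem_union, Set.mem_ofPred_eq, not_or, not_not, not_lt] at hgood
    exact hω fun t => abs_norm_gradDescent_sub_le hgood.1 hN0 hm hx hn hlam hlam1 htol hη hηn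
      hgood.2 t
  · rw [mul_pow, Real.sq_sqrt (by positivity)]
    field_simp
    ring

end TrainedNorm

section RotationDistance

variable {m M c s : ℕ}

lemma norm_zeroPad (κ : Fin M ↪ Fin m) (V : ConvTensor M c s) : ‖zeroPad κ V‖ = ‖V‖ := by
  rw [← sq_eq_sq₀ (norm_nonneg _) (norm_nonneg _), norm_sq_eq_sum_filter, norm_sq_eq_sum_filter]
  symm
  refine Fintype.sum_of_injective κ κ.injective _ _ (fun r hr => ?_) fun r => ?_
  · suffices filter (zeroPad κ V) r = 0 by rw [this, norm_zero, zero_pow two_ne_zero]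
    ext kl
    exact Function.extend_apply' (fun r => V (r, kl)) (0 : Fin m → ℝ) r hr
  · congr 2
    ext kl
    exact (κ.injective.extend_apply (fun r => V (r, kl)) 0 r).symm

lemma minRotDist_nonneg (A B : ConvTensor m c s) : 0 ≤ minRotDist A B :=
  Real.iInf_nonneg fun _ => div_nonneg (norm_nonneg _) (Real.sqrt_nonneg _)

lemma le_minRotDist {A B : ConvTensor m c s} {t : ℝ} (hA : 0 < ‖A‖) (hB : 0 < ‖B‖)
    (h : t * √(‖A‖ * ‖B‖) ≤ ‖B‖ - ‖A‖) : t ≤ minRotDist A B := by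
  refine le_ciInf fun Q => ?_
  rw [normDist, LinearIsometryEquiv.norm_map, le_div_iff₀ (by positivity)]
  calc t * √(‖A‖ * ‖B‖) ≤ ‖B‖ - ‖Q A‖ := by rwa [Q.norm_map]
    _ ≤ ‖Q A - B‖ := by
      rw [norm_sub_rev]
      exact norm_sub_norm_le _ _

lemma sqrt_mul_le_half_add {α β : ℝ} (hα : 0 ≤ α) (hβ : 0 ≤ β) : √(α * β) ≤ (α + β) / 2 :=
  Real.sqrt_le_iff.mpr ⟨by positivity, by nlinarith [sq_nonneg (α - β)]⟩

-- With `r = √(1 - p)`, so that `p = (1 - r) * (1 + r)`, the inequality has the slack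
-- `(1 - r) ^ 2 * (3 + r) / 4` when `α = r` and `β = 1`.
lemma half_mul_half_add_le_sub {p α β tol : ℝ} (hp : 0 ≤ p) (hp1 : p ≤ 1)
    (htol : tol ≤ p ^ 2 / 16) (hα : |α - √(1 - p)| ≤ tol) (hβ : |β - 1| ≤ tol) :
    p / 2 * ((α + β) / 2) ≤ β - α := by
  set r := √(1 - p)
  have hr0 : 0 ≤ r := Real.sqrt_nonneg _
  have hr1 : r ≤ 1 := Real.sqrt_le_one.mpr (by linarith)
  have hpr : p = (1 - r) * (1 + r) := by
    linear_combination Real.sq_sqrt (by linarith : 0 ≤ 1 - p)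
  have hslack : 1 - r - p / 2 * ((r + 1) / 2) = (1 - r) ^ 2 * (3 + r) / 4 := by
    rw [hpr]
    ring
  have hp2 : p ^ 2 ≤ 4 * (1 - r) ^ 2 := by
    rw [hpr]
    nlinarith [sq_nonneg (1 - r)]
  obtain ⟨-, hα⟩ := abs_le.mp hα
  obtain ⟨hβ1, hβ2⟩ := abs_le.mp hβ
  have hpαβ : p / 2 * ((α + β) / 2) ≤ p / 2 * ((r + 1) / 2) + p / 2 * tol := by
    rw [← mul_add]
    gcongr
    linarith
  nlinarith [sq_nonneg (1 - r), mul_nonneg (sq_nonneg (1 - r)) hr0]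

lemma half_le_minRotDist {A B : ConvTensor m c s} {p L : ℝ} (hp : 0 ≤ p) (hp1 : p < 1)
    (hL : 0 < L) (hA : |‖A‖ - √(1 - p) * L| ≤ p ^ 2 * (1 - p) / 16 * L)
    (hB : |‖B‖ - L| ≤ p ^ 2 * (1 - p) / 16 * L) : p / 2 ≤ minRotDist A B := by
  set tol := p ^ 2 * (1 - p) / 16 with htol
  have hp2 : p ^ 2 ≤ 1 := pow_le_one₀ hp hp1.le
  have hsqrt : 1 - p ≤ √(1 - p) := Real.le_sqrt_of_sq_le (by nlinarith)
  have hA0 : 0 < ‖A‖ := by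
    have : tol * L < √(1 - p) * L := by
      gcongr
      nlinarith
    linarith [neg_abs_le (‖A‖ - √(1 - p) * L)]
  have hB0 : 0 < ‖B‖ := by
    have : tol * L < 1 * L := by
      gcongr
      nlinarith
    linarith [neg_abs_le (‖B‖ - L)]
  have hratio : p / 2 * ((‖A‖ / L + ‖B‖ / L) / 2) ≤ ‖B‖ / L - ‖A‖ / L := by
    refine half_mul_half_add_le_sub hp hp1.le (tol := tol) (by nlinarith) ?_ ?_
    · rwa [div_sub' hL.ne', abs_div, abs_of_pos hL, div_le_iff₀ hL, mul_comm L]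
    · rwa [div_sub_one hL.ne', abs_div, abs_of_pos hL, div_le_iff₀ hL]
  refine le_minRotDist hA0 hB0 ?_
  calc p / 2 * √(‖A‖ * ‖B‖) ≤ p / 2 * ((‖A‖ + ‖B‖) / 2) := by
        gcongr
        exact sqrt_mul_le_half_add (norm_nonneg _) (norm_nonneg _)
    _ = p / 2 * ((‖A‖ / L + ‖B‖ / L) / 2) * L := by field_simp
    _ ≤ (‖B‖ / L - ‖A‖ / L) * L := by gcongr
    _ = ‖B‖ - ‖A‖ := by field_simp

end RotationDistance

lemma exists_measurableSet_of_measureReal_not_le {Ω : Type*} [MeasurableSpace Ω] {P : Measure Ω}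
    [IsProbabilityMeasure P] {δ : ℝ} {p q : Ω → Prop} (hp : P.real {ω | ¬p ω} ≤ δ / 2)
    (hq : P.real {ω | ¬q ω} ≤ δ / 2) :
    ∃ E, MeasurableSet E ∧ 1 - δ ≤ P.real E ∧ ∀ ω ∈ E, p ω ∧ q ω := by
  set S := {ω | ¬p ω} ∪ {ω | ¬q ω} with hS
  refine ⟨(toMeasurable P S)ᶜ, (measurableSet_toMeasurable P S).compl, ?_, fun ω hω => ?_⟩
  · rw [probReal_compl_eq_one_sub (measurableSet_toMeasurable P S), measureReal_def,
      measure_toMeasurable, ← measureReal_def]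
    linarith [measureReal_union_le (μ := P) {ω | ¬p ω} {ω | ¬q ω}]
  · have hωS : ω ∉ S := fun h => hω (subset_toMeasurable P S h)
    simpa [hS] using hωS

lemma mul_norm_sq_le_mul_reluGram_of_mem_lowerBounds {n c D s : ℕ} [NeZero D]
    {x : Fin n → Input c D} {q q' lam : ℝ} (hq : 0 < q) (hqq' : q ≤ q') (hlam : 0 ≤ lam)
    (h : lam ∈ lowerBounds {μ : ℝ | Module.End.HasEigenvalue (Matrix.toLin' (gramLimit s q x)) μ})
    (e : EuclideanSpace ℝ (Fin n)) :
    lam * ‖e‖ ^ 2 ≤ q' * (e ⬝ᵥ Matrix.mulVec (reluGram fun i => patch s (x i)) e) := by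
  rw [gramLimit_eq_smul_reluGram] at h
  have hG := (isHermitian_reluGram fun i => patch s (x i)).smul (IsSelfAdjoint.all q)
  have hquad := mul_norm_sq_le_of_mem_lowerBounds_eigenvalues hG h e
  rw [Matrix.smul_mulVec, dotProduct_smul, smul_eq_mul] at hquad
  have hnonneg : 0 ≤ e ⬝ᵥ Matrix.mulVec (reluGram fun i => patch s (x i)) e :=
    nonneg_of_mul_nonneg_right (le_trans (by positivity) hquad) hq
  exact hquad.trans (mul_le_mul_of_nonneg_right hqq' hnonneg)

lemma sqrt_le_sqrt_mul_of_norm_patch_eq_one {c D s : ℕ} {x : Input c D} {j : ZMod D}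
    (hx : ‖patch s x j‖ = 1) (m : ℕ) : √m ≤ √(m * (c * (2 * s + 1))) := by
  have hc : c ≠ 0 := by
    rintro rfl
    rw [Subsingleton.elim (patch s x j) 0, norm_zero] at hx
    exact zero_ne_one hx
  have hc1 : 1 ≤ c * (2 * s + 1) := Nat.one_le_iff_ne_zero.mpr (by positivity)
  exact Real.sqrt_le_sqrt (le_mul_of_one_le_right (by positivity) (by exact_mod_cast hc1))

end ORCNN

end
theorem theorem2 :
    ∃ (K : ℕ) (c₀ : ℝ), 0 < c₀ ∧
    ∀ (p B : ℝ), 0 ≤ p → p < 1 → 0 ≤ B →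
    ∃ C : ℝ, 0 < C ∧
    ∀ (n c D s : ℕ) [NeZero D] (x : Fin n → ORCNN.Input c D) (y : Fin n → ℝ) (lam : ℝ),
      0 < n →
      (∀ i j, ‖ORCNN.patch s (x i) j‖ = 1) →
      (∀ i, |y i| ≤ B) →
      0 < lam →
      IsLeast {μ : ℝ | Module.End.HasEigenvalue
        (Matrix.toLin' (ORCNN.gramLimit s (1 - p) x)) μ} lam →
    ∀ (δ : ℝ), 0 < δ → δ < 1 →
    ∀ (m M : ℕ), C * ((n : ℝ) / lam) ^ K / δ ^ 2 ≤ (m : ℝ) → (M : ℝ) = (1 - p) * (m : ℝ) →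
    ∀ (ηpre ηfin : ℝ), 0 < ηpre → ηpre ≤ c₀ * lam / (n : ℝ) ^ 2 →
      0 < ηfin → ηfin ≤ c₀ * lam / (n : ℝ) ^ 2 →
    ∀ {Ω : Type*} [MeasurableSpace Ω] (P : MeasureTheory.Measure Ω)
      [MeasureTheory.IsProbabilityMeasure P]
      (a₀ : Ω → Fin m → ℝ) (W₀ : Ω → ORCNN.ConvTensor m c s) (κ : Ω → (Fin M ↪ Fin m)),
      ProbabilityTheory.HasLaw (fun ω => (a₀ ω, W₀ ω)) (ORCNN.initLaw m c s) P →
      ProbabilityTheory.HasLaw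
        (fun ω => (a₀ ω ∘ κ ω, ORCNN.keepFilters (κ ω) (W₀ ω))) (ORCNN.initLaw M c s) P →
    ∃ E : Set Ω, MeasurableSet E ∧ 1 - δ ≤ P.real E ∧
      ∀ ω ∈ E, ∀ tpre tfin : ℕ,
        p / 2 ≤ ORCNN.minRotDist
          (ORCNN.zeroPad (κ ω) (ORCNN.gradDescent m (a₀ ω ∘ κ ω) x y ηfin
            (ORCNN.keepFilters (κ ω) (W₀ ω)) tfin))
          (ORCNN.gradDescent m (a₀ ω) x y ηpre (W₀ ω) tpre) := by
  refine ⟨5, 1 / 2, one_half_pos, fun p B hp hp1 _ => ⟨ORCNN.widthConst B (p ^ 2 * (1 - p) / 16),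
    ORCNN.widthConst_pos _ _, ?_⟩⟩
  intro n c D s _ x y lam hn hx hy hlam hleast δ hδ hδ1 m M hm hM ηpre ηfin hpre hpre' hfin hfin'
    Ω _ P _ a₀ W₀ κ hlaw hlaw'
  rcases hp.eq_or_lt with rfl | hp0
  · exact ⟨.univ, .univ, by simp [hδ.le], by simp [ORCNN.minRotDist_nonneg]⟩
  have hq : 0 < 1 - p := sub_pos.mpr hp1
  have hm0 : (0 : ℝ) < m := ORCNN.pos_of_widthConst_le (by positivity) hlam hδ hm
  have hMm : M ≤ m := Nat.cast_le.mp (hM.trans_le (mul_le_of_le_one_left hm0.le (by linarith)))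
  have htol0 : 0 < p ^ 2 * (1 - p) / 16 := by positivity
  have htol : p ^ 2 * (1 - p) / 16 ≤ 1 / 8 := by nlinarith [pow_le_one₀ hp hp1.le (n := 2)]
  have hgram {q : ℝ} (hq1 : 1 - p ≤ q) :=
    ORCNN.mul_norm_sq_le_mul_reluGram_of_mem_lowerBounds hq hq1 hlam.le hleast.2
  have hfinNorm := ORCNN.measureReal_not_abs_norm_gradDescent_sub_le hlaw' hMm hx hn hy hlam
    htol0 htol (hgram (eq_div_of_mul_eq hm0.ne' hM.symm).le) hδ hδ1 hm hfin hfin'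
  have hpreNorm := ORCNN.measureReal_not_abs_norm_gradDescent_sub_le hlaw le_rfl hx hn hy hlam
    htol0 htol (hgram (by rw [div_self hm0.ne']; linarith)) hδ hδ1 hm hpre hpre'
  obtain ⟨E, hE, hPE, hnorm⟩ := ORCNN.exists_measurableSet_of_measureReal_not_le hfinNorm hpreNorm
  have hL := ORCNN.sqrt_le_sqrt_mul_of_norm_patch_eq_one (hx ⟨0, hn⟩ 0) m
  refine ⟨E, hE, hPE, fun ω hω tpre tfin => ORCNN.half_le_minRotDist hp hp1
    ((Real.sqrt_pos.mpr hm0).trans_le hL) ?_ (((hnorm ω hω).2 tpre).trans (by gcongr))⟩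
  rw [ORCNN.norm_zeroPad, ← Real.sqrt_mul hq.le, ← mul_assoc, ← hM]
  exact ((hnorm ω hω).1 tfin).trans (by gcongr)
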